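/- **Setting.** Let $K$ be a connected, locally contractible topological group and let $\eta\colon P\to\Sigma$ be a continuous (locally trivial) principal $K$-bundle over a closed orientable surface $\Sigma$ of genus $g\ge 0$. Let $I=[0,1]$. The surface is presented as the quotient $q\colon I^2\to\Sigma$ of the square: for $g\ge1$ its boundary, run through counterclockwise from $(0,0)$ by $c\colon I\to\partial I^2$, is divided into $4g$ arcs which are identified according to the word $a_1b_1a_1^{-1}b_1^{-1}\cdots a_gb_ga_g^{-1}b_g^{-1}$; for $g=0$ the boundary is collapsed to a point. Choose a continuous $\sigma\colon I^2\to P$ with $\eta\circ\sigma=q$ and a loop $\gamma\colon I\to K$ with $\gamma(0)=\gamma(1)=e$ such that $s(t):=\sigma(c(t))\cdot\gamma(t)$ depends only on $q(c(t))$, i.e. such that $s$ is a section of $P$ over the $1$-skeleton $q(\partial I^2)$. Let $b=[\gamma]\in\pi_1(K)$ be the resulting characteristic class of $P$ and let $p_0=\sigma(0,0)$ be the base point of $P$. Let $$C(P,K)^K=\{f\in C(P,K): f(p\cdot k)=k^{-1}f(p)k\ \text{ for all } p\in P,\ k\in K\}$$ with the compact-open topology, $\mathrm{ev}_{p_0}\colon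 C(P,K)^K\to K$, $f\mapsto f(p_0)$, and $C_*(P,K)^K=\mathrm{ev}_{p_0}^{-1}(e)$. Homotopy groups are formed with maps $I^n\to Y$ sending $\partial I^n$ to the base point; base points are the neutral elements; $\pi_0$ is regarded as a pointed set. **Proposition.** The evaluation map $\mathrm{ev}_{p_0}$ is a Serre fibration, and there is a long exact sequence $$\cdots\to\pi_{n+1}(C(P,K)^K)\to\pi_{n+1}(K)\xrightarrow{\ \delta_{n+1}\ }\pi_{n+1}(K)^{2g}\oplus\pi_{n+2}(K)\to\pi_n(C(P,K)^K)\to\pi_n(K)\to\cdots\qquad(n\ge0),$$ ending at $\pi_0(C(P,K)^K)\to\pi_0(K)$, whose connecting maps are $$\delta_{n+1}(a)=(0,-\langle a,b\rangle)\qquad(a\in\pi_{n+1}(K),\ n\ge0),$$ where $\langle a,b\rangle\in\pi_{n+2}(K)$ is the Samelson product, represented by $(x,y)\mapsto\alpha(x)\beta(y)\alpha(x)^{-1}\beta(y)^{-1}$ on $I^{n+1}\times I$ if $\alpha,\beta$ represent $a,b$. More precisely, this is the long exact homotopy sequence of the fibration $\mathrm{ev}_{p_0}$ with fibre $C_*(P,K)^K$.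 Its connecting map $\delta_{n+1}\colon\pi_{n+1}(K)\to\pi_n(C_*(P,K)^K)$ sends $a$ to the class of the restriction to $I^n\times\{1\}$ of a lift $I^{n+1}\to C(P,K)^K$ of a representative of $a$, where the lift is constantly $e$ on the other faces of the cube; it is a homomorphism for $n\ge1$. There are bijections of pointed sets $$\theta_n\colon\pi_n(C_*(P,K)^K)\to\pi_{n+1}(K)^{2g}\oplus\pi_{n+2}(K)\qquad(n\ge0),$$ which are group isomorphisms for $n\ge1$, such that $\theta_n(\delta_{n+1}(a))=(0,-\langle a,b\rangle)$ and, moreover: 1. the $2g$ components of $\theta_n([G])$ in $\pi_{n+1}(K)$ are represented by the maps $(z,u)\mapsto G(z)(s(t_j(u)))$ on $I^n\times I$, where $t_j\colon I\to I$ parametrizes affinely, in increasing order, the $j$-th of the $2g$ arcs labelled $a_1,b_1,\dots,a_g,b_g$; 2. for every $h\colon I^n\times I^2\to K$ representing a class in $\pi_{n+2}(K)$ there is $G\colon I^n\to C_*(P,K)^K$ representing a class in $\pi_n(C_*(P,K)^K)$ with $G(z)(\sigma(w))=h(z,w)$ for all $z\in I^n$, $w\in I^2$, and $\theta_n([G])=(0,[h])$.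 -/

import Mathlib

open scoped Topology unitInterval Topology.Homotopy
open MulOpposite (op)

noncomputable section

/-! ### Homotopy groups: base point, induced maps, Samelson product, connecting relation -/

/-- The class of the constant map, i.e. the base point of the pointed set `π_N(X, x)`
(the neutral element when `N` is nonempty). -/
def HomotopyGroup.basePt {N X : Type*} [TopologicalSpace X] (x : X) : HomotopyGroup N X x :=
  (⟦GenLoop.const⟧ : Quotient (GenLoop.Homotopic.setoid N x))

/-- The class in `π_N(X, x)` of a map of the cube sending the boundary to `x`. -/
def HomotopyGroup.cls {N X : Type*} [TopologicalSpace X] {x : X} (f : Ω^ N X x) :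
    HomotopyGroup N X x :=
  (⟦f⟧ : Quotient (GenLoop.Homotopic.setoid N x))

/-- Postcomposition of a generalized loop with a pointed map. -/
def GenLoop.mapPt {N X Y : Type*} [TopologicalSpace X] [TopologicalSpace Y] {x : X} {y : Y}
    (f : C(X, Y)) (h : f x = y) (a : Ω^ N X x) : Ω^ N Y y :=
  ⟨f.comp a.1, fun z hz => by
    have ha : a.1 z = x := a.2 z hz
    simp [ha, h]⟩

/-- The map induced on homotopy groups (pointed sets) by a pointed map. -/
def HomotopyGroup.mapPt {N X Y : Type*} [TopologicalSpace X] [TopologicalSpace Y] {x : X} {y : Y}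
    (f : C(X, Y)) (h : f x = y) : HomotopyGroup N X x → HomotopyGroup N Y y :=
  Quotient.map (GenLoop.mapPt f h) fun _ _ hab => hab.map fun H => H.compContinuousMap f

/-- The map `(x, y) ↦ α(x) β(y) α(x)⁻¹ β(y)⁻¹` on the cube `I^(m+n) = I^m × I^n`. -/
def GenLoop.commutator {K : Type*} [Group K] [TopologicalSpace K] [IsTopologicalGroup K]
    {m n : ℕ} (α : Ω^ (Fin m) K 1) (β : Ω^ (Fin n) K 1) : Ω^ (Fin (m + n)) K 1 :=
  ⟨⟨fun z => α.1 (fun i => z (Fin.castAdd n i)) * β.1 (fun j => z (Fin.natAdd m j)) *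
      (α.1 (fun i => z (Fin.castAdd n i)))⁻¹ * (β.1 (fun j => z (Fin.natAdd m j)))⁻¹,
      by fun_prop⟩, by
    rintro z ⟨i, hi⟩
    induction i using Fin.addCases with
    | left i =>
      have h : α (fun i => z (Fin.castAdd n i)) = 1 := α.2 _ ⟨i, hi⟩
      simp [h]
    | right j =>
      have h : β (fun j => z (Fin.natAdd m j)) = 1 := β.2 _ ⟨j, hi⟩
      simp [h]⟩

/-- Homotopic arguments give homotopic commutator maps. -/
theorem GenLoop.commutator_homotopic {K : Type*} [Group K] [TopologicalSpace K]
    [IsTopologicalGroup K] {m n : ℕ} {α α' : Ω^ (Fin m) K 1} {β β' : Ω^ (Fin n) K 1}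
    (hα : GenLoop.Homotopic α α') (hβ : GenLoop.Homotopic β β') :
    GenLoop.Homotopic (GenLoop.commutator α β) (GenLoop.commutator α' β') := by
  obtain ⟨A⟩ := hα
  obtain ⟨B⟩ := hβ
  refine ⟨⟨⟨⟨fun p => A (p.1, fun i => p.2 (Fin.castAdd n i)) *
      B (p.1, fun j => p.2 (Fin.natAdd m j)) *
      (A (p.1, fun i => p.2 (Fin.castAdd n i)))⁻¹ *
      (B (p.1, fun j => p.2 (Fin.natAdd m j)))⁻¹, by fun_prop⟩, ?_, ?_⟩, ?_⟩⟩
  · intro z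
    simp [GenLoop.commutator]
  · intro z
    simp [GenLoop.commutator]
  · rintro t z hz
    have hz1 : (GenLoop.commutator α β).1 z = 1 := (GenLoop.commutator α β).2 z hz
    rw [hz1]
    obtain ⟨i, hi⟩ := hz
    induction i using Fin.addCases with
    | left i =>
      have hb : (fun i => z (Fin.castAdd n i)) ∈ Cube.boundary (Fin m) := ⟨i, hi⟩
      have h : A (t, fun i => z (Fin.castAdd n i)) = 1 := (A.eq_fst t hb).trans (α.2 _ hb)
      simp [h]
    | right j =>
      have hb : (fun j => z (Fin.natAdd m j)) ∈ Cube.boundary (Fin n) := ⟨j, hi⟩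
      have h : B (t, fun j => z (Fin.natAdd m j)) = 1 := (B.eq_fst t hb).trans (β.2 _ hb)
      simp [h]

/-- The Samelson product `π_m(K) × π_n(K) → π_{m+n}(K)`. -/
def samelson {K : Type*} [Group K] [TopologicalSpace K] [IsTopologicalGroup K] {m n : ℕ} :
    π_ m K 1 → π_ n K 1 → π_ (m + n) K 1 :=
  Quotient.map₂ GenLoop.commutator fun _ _ hα _ _ hβ => GenLoop.commutator_homotopic hα hβ

/-- Homotopy lifting property for all cubes. -/
def IsSerreFibration {E B : Type*} [TopologicalSpace E] [TopologicalSpace B] (p : C(E, B)) :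
    Prop :=
  ∀ (n : ℕ) (H : C((I^ Fin n) × I, B)) (f : C(I^ Fin n, E)), (∀ z, p (f z) = H (z, 0)) →
    ∃ L : C((I^ Fin n) × I, E), (∀ z, L (z, 0) = f z) ∧ ∀ y, p (L y) = H y

/-- `IsConnecting ι p a d`: for a fibration `p : E → B` with inclusion of the fibre `ι : F → E`,
the class `d ∈ π_n(F)` is obtained from `a ∈ π_{n+1}(B)` by the construction of the connecting
homomorphism: some representative of `a` has a lift `L : I^{n+1} → E` which is constant
on all faces except the face where the last coordinate is `1`, and the restriction of `L` to that
face represents `d`. -/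
def IsConnecting {F E B : Type*} [TopologicalSpace F] [TopologicalSpace E] [TopologicalSpace B]
    {x : F} {e : E} {y : B} (ι : C(F, E)) (p : C(E, B)) {n : ℕ}
    (a : π_ (n + 1) B y) (d : π_ n F x) : Prop :=
  ∃ (L : C(I^ Fin (n + 1), E)) (f : Ω^ (Fin (n + 1)) B y) (G : Ω^ (Fin n) F x),
    (∀ z, p (L z) = f z) ∧
    (∀ z, (z (Fin.last n) = 0 ∨ ∃ i : Fin n, z i.castSucc = 0 ∨ z i.castSucc = 1) → L z = e) ∧
    (∀ z, z (Fin.last n) = 1 → L z = ι (G fun i => z i.castSucc)) ∧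
    HomotopyGroup.cls f = a ∧ HomotopyGroup.cls G = d

/-! ### Closed orientable surfaces as polygons with identified sides -/

/-- The boundary of the square `I²`, run through once counterclockwise, starting at `(0, 0)`:
right along the lower side for `t ∈ [0, 1/4]`, then up, left, and down. -/
def squareBoundary (t : I) : I^ Fin 2 :=
  ![Set.projIcc 0 1 zero_le_one (min (4 * (t : ℝ)) (3 - 4 * t)),
    Set.projIcc 0 1 zero_le_one (min (4 * (t : ℝ) - 1) (4 - 4 * t))]

/-- The parameter `(m + s) / 4g`: for `m < 4g`, this runs through the `m`-th of the `4g` arcs into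
which the boundary of the square is divided, as `s` runs through `I`. -/
def arcParam (g m : ℕ) (s : I) : I :=
  Set.projIcc 0 1 zero_le_one (((m : ℝ) + s) / (4 * g))

/-- The side identifications `a₁ b₁ a₁⁻¹ b₁⁻¹ ⋯ a_g b_g a_g⁻¹ b_g⁻¹` of the `4g`-gon; for `g = 0`
the whole boundary is collapsed to a point. -/
inductive SideRel (g : ℕ) : (I^ Fin 2) → (I^ Fin 2) → Prop
  | a (i : Fin g) (s : I) : SideRel g (squareBoundary (arcParam g (4 * i) s))
      (squareBoundary (arcParam g (4 * i + 2) (unitInterval.symm s)))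
  | b (i : Fin g) (s : I) : SideRel g (squareBoundary (arcParam g (4 * i + 1) s))
      (squareBoundary (arcParam g (4 * i + 3) (unitInterval.symm s)))
  | collapse (hg : g = 0) (t u : I) : SideRel g (squareBoundary t) (squareBoundary u)

/-- `q : I² → X` exhibits `X` as the closed orientable surface of genus `g`, i.e. as the space
obtained from a `4g`-gon by the standard side identifications. -/
structure IsSurfacePresentation {X : Type*} [TopologicalSpace X] (g : ℕ) (q : C(I^ Fin 2, X)) :
    Prop where
  isQuotientMap : Topology.IsQuotientMap q
  eq_iff : ∀ w w', q w = q w' ↔ Relation.EqvGen (SideRel g) w w'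

/-! ### Principal bundles, gauge groups, characteristic classes -/

/-- `η : P → X` is a (locally trivial) principal `K`-bundle, for a right action of `K` on `P`. -/
structure IsPrincipalBundle (K : Type*) {P X : Type*} [Group K] [TopologicalSpace K]
    [TopologicalSpace P] [TopologicalSpace X] [MulAction Kᵐᵒᵖ P] (η : P → X) : Prop where
  continuous_action : Continuous fun x : P × K => op x.2 • x.1
  proj_smul : ∀ (k : K) (p : P), η (op k • p) = η p
  locally_trivial : ∀ x : X, ∃ e : Bundle.Trivialization K η, x ∈ e.baseSet ∧
    ∀ p ∈ e.source, ∀ k : K, (e (op k • p)).2 = (e p).2 * k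

/-- The gauge group `C(P, K)^K`, with the topology induced by the compact-open topology. -/
def gaugeGroup (K P : Type*) [Group K] [TopologicalSpace K] [IsTopologicalGroup K]
    [TopologicalSpace P] [MulAction Kᵐᵒᵖ P] : Subgroup C(P, K) where
  carrier := {f | ∀ (p : P) (k : K), f (op k • p) = k⁻¹ * f p * k}
  mul_mem' := by
    intro f f' hf hf' p k
    simp only [ContinuousMap.mul_apply, hf p k, hf' p k]
    group
  one_mem' := by
    intro p k
    simp
  inv_mem' := by
    intro f hf p k
    simp only [ContinuousMap.inv_apply, hf p k]
    group

/-- The pointed gauge group: the fibre over `1` of the evaluation at `p₀`. -/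
def pointedGaugeGroup (K : Type*) {P : Type*} [Group K] [TopologicalSpace K]
    [IsTopologicalGroup K] [TopologicalSpace P] [MulAction Kᵐᵒᵖ P] (p₀ : P) :
    Subgroup (gaugeGroup K P) where
  carrier := {f | f.1 p₀ = 1}
  mul_mem' := by
    intro f f' hf hf'
    have h : f.1 p₀ = 1 := hf
    have h' : f'.1 p₀ = 1 := hf'
    simp [h, h']
  one_mem' := by simp
  inv_mem' := by
    intro f hf
    have h : f.1 p₀ = 1 := hf
    simp [h]

/-- The evaluation map `C(P, K)^K → K`, `f ↦ f p₀`. -/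
def gaugeEval (K : Type*) {P : Type*} [Group K] [TopologicalSpace K] [IsTopologicalGroup K]
    [TopologicalSpace P] [MulAction Kᵐᵒᵖ P] (p₀ : P) : C(gaugeGroup K P, K) :=
  ⟨fun f => f.1 p₀, by fun_prop⟩

/-- The inclusion of the pointed gauge group into the gauge group. -/
def gaugeIncl (K : Type*) {P : Type*} [Group K] [TopologicalSpace K] [IsTopologicalGroup K]
    [TopologicalSpace P] [MulAction Kᵐᵒᵖ P] (p₀ : P) :
    C(pointedGaugeGroup K p₀, gaugeGroup K P) :=
  ⟨Subtype.val, continuous_subtype_val⟩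

/-- A characteristic map of a principal `K`-bundle `η : P → X` over a surface with quotient map
`q : I² → X`: a lift of `q` to `P` and a loop in `K` at `1`, viewed as a map on the boundary of
the square, such that `lift · loop` descends to a section of `P` over the `1`-skeleton `q(∂I²)`. -/
structure CharacteristicMap (K : Type*) {P X : Type*} [Group K] [TopologicalSpace K]
    [TopologicalSpace P] [TopologicalSpace X] [MulAction Kᵐᵒᵖ P]
    (q : C(I^ Fin 2, X)) (η : P → X) where
  lift : C(I^ Fin 2, P)
  loop : Ω^ (Fin 1) K 1
  proj_lift : ∀ w, η (lift w) = q w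
  compat : ∀ t u : I, q (squareBoundary t) = q (squareBoundary u) →
    op (loop fun _ => t) • lift (squareBoundary t) =
      op (loop fun _ => u) • lift (squareBoundary u)

namespace CharacteristicMap

variable {K P X : Type*} [Group K] [TopologicalSpace K] [TopologicalSpace P] [TopologicalSpace X]
  [MulAction Kᵐᵒᵖ P] {q : C(I^ Fin 2, X)} {η : P → X}

/-- The class of the characteristic map in `π_1(K)`. -/
def charClass (T : CharacteristicMap K q η) : π_ 1 K 1 := HomotopyGroup.cls T.loop

/-- The base point of `P`, lying over the vertex of the surface. -/
def basePoint (T : CharacteristicMap K q η) : P := T.lift (squareBoundary 0)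

/-- The section `lift · loop` over the `1`-skeleton, at the boundary parameter `t`. -/
def skeletonSection (T : CharacteristicMap K q η) (t : I) : P :=
  op (T.loop fun _ => t) • T.lift (squareBoundary t)

end CharacteristicMap

end

/-!
A gauge transformation `f` is determined by the function `w ↦ f (T.lift w)` on the square, and the
functions on the square which arise are those satisfying a compatibility condition on the boundary
(`CharacteristicMap.Compatible`); continuous families of such functions define continuous families
of gauge transformations (`continuous_gaugeExt`). In terms of the section over the `1`-skeleton, the
function has the value `γ(u) f(s(u)) γ(u)⁻¹` at the boundary parameter `u`, where `γ` is the
characteristic loop.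

*The splitting.* The restriction of a pointed gauge transformation to the circles `aᵢ`, `bᵢ` is a
family of `2g` loops `x` in `K`, and on the boundary of the polygon it runs through the word
`a₁ b₁ a₁⁻¹ b₁⁻¹ ⋯`. Since `K` is a group, this word is the pointwise product of the loops
`xₐ ∘ tent`, where `tent` increases on the side `a`, is `1` on the next side, and decreases on the
side `a⁻¹`. Replacing `tent` by `v · tent` contracts all of them at once (`wordHomotopy`), and in
polar coordinates on the square this is an extension of the given boundary values, continuous in
`x` and trivial for trivial `x` (`CharacteristicMap.fill`). Dividing by it leaves a function on the
square which is `1` on the boundary. Thus pointed gauge transformations correspond to pairs of `2g`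
loops and a `2`-sphere in `K`, continuously in both directions, and this gives the isomorphism of
homotopy groups (`splitting_bijective`, `splitting_mul`).

*The fibration.* A path `κ` in `K` starting at `1` is lifted to the path of gauge transformations
which is constantly `κ(t)` on the `1`-skeleton and is given by `[γ(u), κ(tv)] κ(t)` in polar
coordinates `(u, v)` (`exists_path_lift`). Constant paths have constant lifts. Together with the
group structures, such a lifting yields the Serre fibration, the connecting map and the exact
sequence by multiplying homotopies pointwise (`HasRegularLifting`).

*The connecting map.* By the formula for the lift, the end of the lift of `α` is, in polar
coordinates, the inverse of the commutator `[α(z, v), γ(u)]`. Polar coordinates `(v, u)` are a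
self-map of the square of degree one (`GenLoop.homotopic_comp_squarePolar`), so that this end
represents the inverse of the Samelson product.
-/

/-! ### Homotopy classes of cubes in a topological group -/

section GroupLoops

variable {N X : Type*} [TopologicalSpace X] {x : X}

theorem GenLoop.homotopic_iff {f g : Ω^ N X x} : GenLoop.Homotopic f g ↔
    ∃ H : C(I × (I^N), X), (∀ z, H (0, z) = f z) ∧ (∀ z, H (1, z) = g z) ∧
      ∀ t, ∀ z ∈ Cube.boundary N, H (t, z) = x := by
  constructor
  · rintro ⟨H⟩
    exact ⟨H.toContinuousMap, H.apply_zero, H.apply_one,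
      fun t z hz => (H.eq_fst t hz).trans (f.2 z hz)⟩
  · rintro ⟨H, h0, h1, hb⟩
    exact ⟨⟨⟨H, h0, h1⟩, fun t z hz => (hb t z hz).trans (f.2 z hz).symm⟩⟩

theorem HomotopyGroup.cls_eq_iff {f g : Ω^ N X x} :
    HomotopyGroup.cls f = HomotopyGroup.cls g ↔ GenLoop.Homotopic f g :=
  Quotient.eq (r := GenLoop.Homotopic.setoid N x)

theorem HomotopyGroup.exists_cls (a : HomotopyGroup N X x) : ∃ f, HomotopyGroup.cls f = a :=
  Quotient.exists_rep (s := GenLoop.Homotopic.setoid N x) a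

theorem HomotopyGroup.cls_const : HomotopyGroup.cls (GenLoop.const : Ω^ N X x) = basePt x := rfl

variable {K : Type*} [Group K] [TopologicalSpace K] [IsTopologicalGroup K]

/-- The pointwise product of two maps of the cube into a topological group. -/
def GenLoop.pointwiseMul (f g : Ω^ N K 1) : Ω^ N K 1 :=
  ⟨f.1 * g.1, fun z hz => by
    have hf : f.1 z = 1 := f.2 z hz
    have hg : g.1 z = 1 := g.2 z hz
    simp [hf, hg]⟩

/-- The pointwise inverse of a map of the cube into a topological group. -/
def GenLoop.pointwiseInv (f : Ω^ N K 1) : Ω^ N K 1 :=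
  ⟨f.1⁻¹, fun z hz => by
    have hf : f.1 z = 1 := f.2 z hz
    simp [hf]⟩

@[simp] theorem GenLoop.pointwiseMul_apply (f g : Ω^ N K 1) (z : I^N) :
    GenLoop.pointwiseMul f g z = f z * g z := rfl

@[simp] theorem GenLoop.pointwiseInv_apply (f : Ω^ N K 1) (z : I^N) :
    GenLoop.pointwiseInv f z = (f z)⁻¹ := rfl

theorem GenLoop.Homotopic.pointwiseMul {f f' g g' : Ω^ N K 1} (hf : GenLoop.Homotopic f f')
    (hg : GenLoop.Homotopic g g') :
    GenLoop.Homotopic (GenLoop.pointwiseMul f g) (GenLoop.pointwiseMul f' g') := by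
  rw [GenLoop.homotopic_iff] at *
  obtain ⟨A, a0, a1, ab⟩ := hf
  obtain ⟨B, b0, b1, bb⟩ := hg
  refine ⟨A * B, fun z => ?_, fun z => ?_, fun t z hz => ?_⟩
  · simp [a0, b0]
  · simp [a1, b1]
  · simp [ab t z hz, bb t z hz]

theorem GenLoop.transAt_apply [DecidableEq N] (i : N) (f g : Ω^ N X x) (t : I^N) :
    GenLoop.transAt i f g t = if (t i : ℝ) ≤ 1 / 2
      then f (Function.update t i <| Set.projIcc 0 1 zero_le_one (2 * t i))
      else g (Function.update t i <| Set.projIcc 0 1 zero_le_one (2 * t i - 1)) := rfl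

/-- The product of homotopy classes may be computed by concatenation in any coordinate. -/
theorem HomotopyGroup.cls_mul [DecidableEq N] [Nonempty N] (i : N) (f g : Ω^ N X x) :
    HomotopyGroup.cls f * HomotopyGroup.cls g = HomotopyGroup.cls (GenLoop.transAt i g f) :=
  HomotopyGroup.mul_spec

/-- In a topological group, the product of homotopy classes is represented by the pointwise
product. -/
theorem HomotopyGroup.cls_pointwiseMul [DecidableEq N] [Nonempty N] (f g : Ω^ N K 1) :
    HomotopyGroup.cls (GenLoop.pointwiseMul f g) = HomotopyGroup.cls f * HomotopyGroup.cls g := by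
  obtain ⟨i⟩ := ‹Nonempty N›
  have e1 : GenLoop.transAt i g f = GenLoop.pointwiseMul (GenLoop.transAt i GenLoop.const f)
      (GenLoop.transAt i g GenLoop.const) := by
    ext z
    simp only [GenLoop.transAt_apply, GenLoop.pointwiseMul_apply]
    split_ifs <;> simp
  have hc : HomotopyGroup.cls (GenLoop.const : Ω^ N K 1) = 1 := rfl
  have h1 : GenLoop.Homotopic (GenLoop.transAt i GenLoop.const f) f := by
    rw [← HomotopyGroup.cls_eq_iff, ← HomotopyGroup.cls_mul, hc, mul_one]
  have h2 : GenLoop.Homotopic (GenLoop.transAt i g GenLoop.const) g := by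
    rw [← HomotopyGroup.cls_eq_iff, ← HomotopyGroup.cls_mul, hc, one_mul]
  rw [HomotopyGroup.cls_mul i, HomotopyGroup.cls_eq_iff, e1]
  exact (h1.pointwiseMul h2).symm

theorem HomotopyGroup.cls_pointwiseInv [DecidableEq N] [Nonempty N] (f : Ω^ N K 1) :
    HomotopyGroup.cls (GenLoop.pointwiseInv f) = (HomotopyGroup.cls f)⁻¹ := by
  rw [eq_inv_iff_mul_eq_one, ← HomotopyGroup.cls_pointwiseMul]
  have : GenLoop.pointwiseMul (GenLoop.pointwiseInv f) f = GenLoop.const := by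
    ext z
    simp
  rw [this]
  rfl

end GroupLoops

/-! ### The homotopy sequence of a homomorphism with regular path lifting -/

section RegularLifting

theorem Cube.mem_boundary_succ {n : ℕ} {z : I^ Fin (n + 1)} : z ∈ Cube.boundary (Fin (n + 1)) ↔
    (Fin.init z : I^ Fin n) ∈ Cube.boundary (Fin n) ∨ z (Fin.last n) = 0 ∨ z (Fin.last n) = 1 := by
  simp only [Cube.boundary, Set.mem_ofPred_eq, Fin.exists_fin_succ', Fin.init]

@[fun_prop]
theorem Continuous.cubeSnoc {n : ℕ} {Y : Type*} [TopologicalSpace Y] {f : Y → I^ Fin n} {h : Y → I}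
    (hf : Continuous f) (hh : Continuous h) :
    Continuous fun y => (Fin.snoc (f y) (h y) : I^ Fin (n + 1)) :=
  hf.finSnoc hh

@[fun_prop]
theorem Continuous.cubeInit {n : ℕ} {Y : Type*} [TopologicalSpace Y] {f : Y → I^ Fin (n + 1)}
    (hf : Continuous f) : Continuous fun y => (Fin.init (f y) : I^ Fin n) :=
  continuous_pi fun i => (continuous_apply i.castSucc).comp hf

theorem Cube.snoc_mem_boundary_iff {n : ℕ} {z : I^ Fin n} {t : I} :
    (Fin.snoc z t : I^ Fin (n + 1)) ∈ Cube.boundary (Fin (n + 1)) ↔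
      z ∈ Cube.boundary (Fin n) ∨ t = 0 ∨ t = 1 := by
  rw [Cube.mem_boundary_succ, Fin.init_snoc, Fin.snoc_last]

variable {E B : Type*} [Group E] [TopologicalSpace E] [Group B] [TopologicalSpace B]

/-- Families of paths starting at `1` and parametrized by cubes lift to families of paths
starting at `1`, and constant paths of the family are lifted to constant paths. -/
def HasRegularLifting (p : C(E, B)) : Prop :=
  ∀ (n : ℕ) (κ : C((I^ Fin n) × I, B)), (∀ z, κ (z, 0) = 1) →
    ∃ L : C((I^ Fin n) × I, E), (∀ z, L (z, 0) = 1) ∧ (∀ y, p (L y) = κ y) ∧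
      ∀ z, (∀ t, κ (z, t) = 1) → ∀ t, L (z, t) = 1

variable {p : C(E, B)}

theorem map_inv_of_map_mul (hp : ∀ x y, p (x * y) = p x * p y) (x : E) : p x⁻¹ = (p x)⁻¹ :=
  (MonoidHom.mk' p hp).map_inv x

theorem HasRegularLifting.isSerreFibration [IsTopologicalGroup E] [IsTopologicalGroup B]
    (hL : HasRegularLifting p) (hp : ∀ x y, p (x * y) = p x * p y) : IsSerreFibration p := by
  intro n H f hf
  obtain ⟨L, L0, Lp, -⟩ := hL n
    ⟨fun y => (H (y.1, 0))⁻¹ * H y, by fun_prop⟩ (fun z => by simp)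
  refine ⟨⟨fun y => f y.1 * L y, by fun_prop⟩, fun z => by simp [L0], fun y => ?_⟩
  simp [hp, hf, Lp]

/-- A family of loops in the base which is contracted by `H` through loops lifts to a family of
loops in the total space. -/
theorem HasRegularLifting.exists_lift_of_homotopy (hL : HasRegularLifting p) {n : ℕ}
    {f : (I^ Fin n) → B} (H : C(I × (I^ Fin n), B)) (h0 : ∀ z, H (0, z) = 1)
    (h1 : ∀ z, H (1, z) = f z) (hb : ∀ t, ∀ z ∈ Cube.boundary (Fin n), H (t, z) = 1) :
    ∃ M : C(I × (I^ Fin n), E), (∀ z, M (0, z) = 1) ∧ (∀ z, p (M (1, z)) = f z) ∧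
      ∀ t, ∀ z ∈ Cube.boundary (Fin n), M (t, z) = 1 := by
  obtain ⟨L, L0, Lp, Lc⟩ := hL n ⟨fun y => H (y.2, y.1), by fun_prop⟩ h0
  refine ⟨⟨fun y => L (y.2, y.1), by fun_prop⟩, L0, fun z => ?_, fun t z hz => ?_⟩
  · simp [Lp, h1]
  · exact Lc z (fun t => hb t z hz) t

variable {F : Subgroup E}

/-- The inclusion of a subgroup as a continuous map. -/
def Subgroup.inclusionMap (F : Subgroup E) : C(F, E) := ⟨Subtype.val, continuous_subtype_val⟩

@[simp] theorem Subgroup.inclusionMap_apply (x : F) : F.inclusionMap x = x := rfl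

/-- The lift defining the connecting map, as a homotopy from the constant map. -/
theorem IsConnecting.exists_homotopy {n : ℕ} {a : π_ (n + 1) B 1} {d : π_ n F 1}
    (h : IsConnecting (e := (1 : E)) F.inclusionMap p a d) :
    ∃ (L : C(I × (I^ Fin n), E)) (f : Ω^ (Fin (n + 1)) B 1) (G : Ω^ (Fin n) F 1),
      (∀ t z, p (L (t, z)) = f (Fin.snoc z t)) ∧ (∀ z, L (0, z) = 1) ∧
      (∀ z, L (1, z) = (G z : E)) ∧ (∀ t, ∀ z ∈ Cube.boundary (Fin n), L (t, z) = 1) ∧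
      HomotopyGroup.cls f = a ∧ HomotopyGroup.cls G = d := by
  obtain ⟨L, f, G, hp, h0, h1, rfl, rfl⟩ := h
  refine ⟨⟨fun y => L (Fin.snoc y.2 y.1), by fun_prop⟩, f, G, fun t z => hp _,
    fun z => h0 _ (by simp), fun z => ?_, fun t z hz => ?_, rfl, rfl⟩
  · have := h1 (Fin.snoc z 1) (by simp)
    simpa using this
  · exact h0 _ (Or.inr (by simpa [Cube.boundary] using hz))

/-- A homotopy in the total space from the constant map to a cube in the fibre, relative to the
boundary, is a lift as required for the connecting relation. -/
theorem IsConnecting.of_homotopy {n : ℕ} (L : C(I × (I^ Fin n), E)) (f : Ω^ (Fin (n + 1)) B 1)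
    (G : Ω^ (Fin n) F 1) (hp : ∀ t z, p (L (t, z)) = f (Fin.snoc z t)) (h0 : ∀ z, L (0, z) = 1)
    (h1 : ∀ z, L (1, z) = (G z : E)) (hb : ∀ t, ∀ z ∈ Cube.boundary (Fin n), L (t, z) = 1) :
    IsConnecting (e := (1 : E)) F.inclusionMap p (HomotopyGroup.cls f) (HomotopyGroup.cls G) := by
  refine ⟨⟨fun z => L (z (Fin.last n), Fin.init z), by fun_prop⟩, f, G,
    fun z => ?_, ?_, fun z hz => ?_, rfl, rfl⟩
  · simp [hp]
  · rintro z (hz | hz)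
    · simp [hz, h0]
    · exact hb _ _ hz
  · simp only [ContinuousMap.coe_mk, hz, h1]
    rfl

/-- The connecting construction is single-valued. -/
theorem HasRegularLifting.isConnecting_unique [IsTopologicalGroup E] [IsTopologicalGroup B]
    (hL : HasRegularLifting p)
    (hp : ∀ x y, p (x * y) = p x * p y) (hF : ∀ x, x ∈ F ↔ p x = 1) {n : ℕ}
    {a : π_ (n + 1) B 1} {d d' : π_ n F 1}
    (h : IsConnecting (e := (1 : E)) F.inclusionMap p a d)
    (h' : IsConnecting (e := (1 : E)) F.inclusionMap p a d') : d = d' := by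
  obtain ⟨L, f, G, Lp, L0, L1, Lb, ha, rfl⟩ := h.exists_homotopy
  obtain ⟨L', f', G', Lp', L0', L1', Lb', rfl, rfl⟩ := h'.exists_homotopy
  obtain ⟨H, h0, h1, hb⟩ := GenLoop.homotopic_iff.1 (HomotopyGroup.cls_eq_iff.1 ha)
  obtain ⟨M, M0, M1, Mb⟩ := hL.exists_lift_of_homotopy (f := fun z => (f z)⁻¹ * f' z)
    ⟨fun y => (f y.2)⁻¹ * H y, by fun_prop⟩ (fun z => by simp [h0]) (fun z => by simp [h1])
    (fun t z hz => by
      have : f z = 1 := f.2 z hz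
      simp [hb t z hz, this])
  -- `L⁻¹ L'` and the lift `M` of the contraction of `f⁻¹ f'` differ by a homotopy in the fibre
  let J : I × (I^ Fin n) → E := fun y => (L y)⁻¹ * L' y * (M (1, Fin.snoc y.2 y.1))⁻¹
  have hJF : ∀ y, J y ∈ F := fun y => by
    rw [hF]
    simp only [J, hp, map_inv_of_map_mul hp, Lp, Lp', M1]
    group
  rw [HomotopyGroup.cls_eq_iff, GenLoop.homotopic_iff]
  refine ⟨⟨fun y => G y.2 * ⟨J y, hJF y⟩, by fun_prop⟩, fun z => ?_, fun z => ?_,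
    fun t z hz => ?_⟩
  · have : M (1, Fin.snoc z 0) = 1 := Mb _ _ (Cube.snoc_mem_boundary_iff.2 (by simp))
    exact Subtype.ext (by simp [J, L0, L0', this])
  · have : M (1, Fin.snoc z 1) = 1 := Mb _ _ (Cube.snoc_mem_boundary_iff.2 (by simp))
    exact Subtype.ext (by simp [J, L1, L1', this])
  · have : M (1, Fin.snoc z t) = 1 := Mb _ _ (Cube.snoc_mem_boundary_iff.2 (Or.inl hz))
    have hG : G z = 1 := G.2 z hz
    exact Subtype.ext (by simp [J, Lb t z hz, Lb' t z hz, this, hG])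

/-- The connecting relation is multiplicative, for pointwise products of lifts. -/
theorem IsConnecting.mul [IsTopologicalGroup E] [IsTopologicalGroup B]
    (hp : ∀ x y, p (x * y) = p x * p y) {n : ℕ}
    {a a' : π_ (n + 2) B 1} {d d' : π_ (n + 1) F 1}
    (h : IsConnecting (e := (1 : E)) F.inclusionMap p a d)
    (h' : IsConnecting (e := (1 : E)) F.inclusionMap p a' d') :
    IsConnecting (e := (1 : E)) F.inclusionMap p (a * a') (d * d') := by
  obtain ⟨L, f, G, Lp, L0, L1, Lb, rfl, rfl⟩ := h.exists_homotopy
  obtain ⟨L', f', G', Lp', L0', L1', Lb', rfl, rfl⟩ := h'.exists_homotopy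
  rw [← HomotopyGroup.cls_pointwiseMul, ← HomotopyGroup.cls_pointwiseMul]
  refine IsConnecting.of_homotopy (L * L') _ _ (fun t z => ?_) (fun z => ?_) (fun z => ?_)
    fun t z hz => ?_
  · simp [hp, Lp, Lp']
  · simp [L0, L0']
  · simp [L1, L1']
  · simp [Lb t z hz, Lb' t z hz]

/-- Exactness at the homotopy groups of the base. -/
theorem isConnecting_basePt_iff [IsTopologicalGroup E]
    (hp : ∀ x y, p (x * y) = p x * p y) (hF : ∀ x, x ∈ F ↔ p x = 1) {n : ℕ}
    (hp1 : p 1 = 1) (a : π_ (n + 1) B 1) :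
    IsConnecting (e := (1 : E)) F.inclusionMap p a (HomotopyGroup.basePt (1 : F)) ↔
      a ∈ Set.range (HomotopyGroup.mapPt (N := Fin (n + 1)) (x := (1 : E)) p hp1) := by
  constructor
  · intro h
    obtain ⟨L, f, G, Lp, L0, L1, Lb, rfl, hG⟩ := h.exists_homotopy
    obtain ⟨H, h0, h1, hb⟩ := GenLoop.homotopic_iff.1
      (HomotopyGroup.cls_eq_iff.1 (hG.trans HomotopyGroup.cls_const.symm))
    -- dividing `L` by a contraction of its end `G` in the fibre gives a sphere in `E` over `f`
    refine ⟨HomotopyGroup.cls ⟨⟨fun z => L (z (Fin.last n), Fin.init z) *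
      ((H (unitInterval.symm (z (Fin.last n)), Fin.init z) : F) : E)⁻¹,
      by fun_prop⟩, fun z hz => ?_⟩, ?_⟩
    · rw [Cube.mem_boundary_succ] at hz
      rcases hz with hz | hz | hz
      · simp [Lb _ _ hz, hb _ _ hz]
      · simp [hz, L0, h1]
      · simp [hz, L1, h0]
    · refine congrArg HomotopyGroup.cls (GenLoop.ext _ _ fun z => ?_)
      have := (hF _).1 (H (unitInterval.symm (z (Fin.last n)), Fin.init z)).2
      refine (hp _ _).trans ?_
      rw [map_inv_of_map_mul hp, this, Lp, Fin.snoc_init_self, inv_one, mul_one]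
  · rintro ⟨c, rfl⟩
    obtain ⟨c, rfl⟩ := HomotopyGroup.exists_cls c
    refine IsConnecting.of_homotopy ⟨fun y => c (Fin.snoc y.2 y.1), by fun_prop⟩
      (GenLoop.mapPt p hp1 c) GenLoop.const (fun t z => rfl) (fun z => ?_) (fun z => ?_)
      fun t z hz => ?_
    · exact c.2 _ (Cube.snoc_mem_boundary_iff.2 (by simp))
    · exact c.2 _ (Cube.snoc_mem_boundary_iff.2 (by simp))
    · exact c.2 _ (Cube.snoc_mem_boundary_iff.2 (Or.inl hz))

/-- Exactness at the homotopy groups of the fibre. -/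
theorem exists_isConnecting_iff (hp1 : p 1 = 1) (hF : ∀ x, x ∈ F ↔ p x = 1) {n : ℕ}
    (d : π_ n F 1) :
    HomotopyGroup.mapPt (y := (1 : E)) F.inclusionMap rfl d = HomotopyGroup.basePt 1 ↔
      ∃ a : π_ (n + 1) B 1, IsConnecting (e := (1 : E)) F.inclusionMap p a d := by
  constructor
  · intro h
    obtain ⟨G, rfl⟩ := HomotopyGroup.exists_cls d
    obtain ⟨H, h0, h1, hb⟩ := GenLoop.homotopic_iff.1
      (HomotopyGroup.cls_eq_iff.1 (HomotopyGroup.cls_const.trans h.symm))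
    have hf : ∀ z ∈ Cube.boundary (Fin (n + 1)), p (H (z (Fin.last n), Fin.init z)) = 1 := by
      intro z hz
      rw [Cube.mem_boundary_succ] at hz
      rcases hz with hz | hz | hz
      · rw [hb _ _ hz, hp1]
      · rw [hz, h0, GenLoop.const_apply, hp1]
      · rw [hz, h1]
        exact (hF _).1 (G (Fin.init z)).2
    refine ⟨_, IsConnecting.of_homotopy H ⟨⟨fun z => p (H (z (Fin.last n), Fin.init z)),
      by fun_prop⟩, hf⟩ G (fun t z => ?_) h0 h1 hb⟩
    change p (H (t, z)) = p (H ((Fin.snoc z t : I^ Fin (n + 1)) (Fin.last n), _))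
    rw [Fin.snoc_last, Fin.init_snoc]
  · rintro ⟨a, h⟩
    obtain ⟨L, f, G, Lp, L0, L1, Lb, rfl, rfl⟩ := h.exists_homotopy
    rw [← HomotopyGroup.cls_const]
    exact (HomotopyGroup.cls_eq_iff.2 (GenLoop.homotopic_iff.2 ⟨L, L0, L1, Lb⟩)).symm

/-- Exactness at the homotopy groups of the total space. -/
theorem HasRegularLifting.mapPt_eq_basePt_iff [IsTopologicalGroup E] (hL : HasRegularLifting p)
    (hp : ∀ x y, p (x * y) = p x * p y) (hF : ∀ x, x ∈ F ↔ p x = 1) {n : ℕ}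
    (hp1 : p 1 = 1) (u : π_ n E 1) :
    HomotopyGroup.mapPt (y := (1 : B)) p hp1 u = HomotopyGroup.basePt 1 ↔
      u ∈ Set.range (HomotopyGroup.mapPt (N := Fin n) (x := (1 : F)) (y := (1 : E))
        F.inclusionMap rfl) := by
  constructor
  · intro h
    obtain ⟨c, rfl⟩ := HomotopyGroup.exists_cls u
    obtain ⟨H, h0, h1, hb⟩ := GenLoop.homotopic_iff.1
      (HomotopyGroup.cls_eq_iff.1 (HomotopyGroup.cls_const.trans h.symm))
    obtain ⟨M, M0, M1, Mb⟩ := hL.exists_lift_of_homotopy H h0 h1 hb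
    have hcF : ∀ z, c z * (M (1, z))⁻¹ ∈ F := fun z => by
      rw [hF, hp, map_inv_of_map_mul hp, M1]
      exact mul_inv_cancel _
    refine ⟨HomotopyGroup.cls ⟨⟨fun z => ⟨c z * (M (1, z))⁻¹, hcF z⟩, by fun_prop⟩,
      fun z hz => ?_⟩, HomotopyGroup.cls_eq_iff.2 (GenLoop.homotopic_iff.2
        ⟨⟨fun y => c y.2 * (M (unitInterval.symm y.1, y.2))⁻¹, by fun_prop⟩,
          fun z => ?_, fun z => ?_, fun t z hz => ?_⟩)⟩
    · have : c z = 1 := c.2 z hz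
      exact Subtype.ext (by simp [this, Mb _ _ hz])
    · simp only [ContinuousMap.coe_mk, unitInterval.symm_zero]
      rfl
    · simp [M0]
    · have : c z = 1 := c.2 z hz
      simp [this, Mb _ _ hz]
  · rintro ⟨c, rfl⟩
    obtain ⟨c, rfl⟩ := HomotopyGroup.exists_cls c
    rw [← HomotopyGroup.cls_const]
    refine congrArg HomotopyGroup.cls (GenLoop.ext _ _ fun z => ?_)
    exact (hF _).1 (c z).2

end RegularLifting

/-! ### Polar coordinates on the square -/

section Polar

theorem coe_squareBoundary_zero (t : I) :
    (squareBoundary t 0 : ℝ) = max 0 (min 1 (min (4 * (t : ℝ)) (3 - 4 * t))) := by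
  simp [squareBoundary, Set.coe_projIcc]

theorem coe_squareBoundary_one (t : I) :
    (squareBoundary t 1 : ℝ) = max 0 (min 1 (min (4 * (t : ℝ) - 1) (4 - 4 * t))) := by
  simp [squareBoundary, Set.coe_projIcc]

@[fun_prop]
theorem continuous_squareBoundary : Continuous squareBoundary := by
  refine continuous_pi fun i => ?_
  fin_cases i
  · exact (continuous_projIcc (h := zero_le_one)).comp
      (f := fun t : I => min _ _) (by fun_prop)
  · exact (continuous_projIcc (h := zero_le_one)).comp
      (f := fun t : I => min _ _) (by fun_prop)

/-- The boundary parametrization on the four sides of the square. -/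
theorem squareBoundary_cases (t : I) :
    ((t : ℝ) ≤ 1 / 4 ∧ (squareBoundary t 0 : ℝ) = 4 * t ∧ (squareBoundary t 1 : ℝ) = 0) ∨
    (1 / 4 ≤ (t : ℝ) ∧ (t : ℝ) ≤ 1 / 2 ∧ (squareBoundary t 0 : ℝ) = 1 ∧
      (squareBoundary t 1 : ℝ) = 4 * t - 1) ∨
    (1 / 2 ≤ (t : ℝ) ∧ (t : ℝ) ≤ 3 / 4 ∧ (squareBoundary t 0 : ℝ) = 3 - 4 * t ∧
      (squareBoundary t 1 : ℝ) = 1) ∨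
    (3 / 4 ≤ (t : ℝ) ∧ (squareBoundary t 0 : ℝ) = 0 ∧ (squareBoundary t 1 : ℝ) = 4 - 4 * t) := by
  rw [coe_squareBoundary_zero, coe_squareBoundary_one]
  rcases t with ⟨t, ht0, ht1⟩
  simp only
  rcases le_total t (1 / 4) with h | h
  · refine Or.inl ⟨h, ?_, ?_⟩
    · rw [min_eq_left (a := 4 * t) (by linarith), min_eq_right (by linarith),
        max_eq_right (by linarith)]
    · rw [min_eq_left (a := 4 * t - 1) (by linarith), min_eq_right (by linarith),
        max_eq_left (by linarith)]
  rcases le_total t (1 / 2) with h' | h'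
  · refine Or.inr (Or.inl ⟨h, h', ?_, ?_⟩)
    · rw [min_eq_left (a := 1) (le_min (by linarith) (by linarith)), max_eq_right (by linarith)]
    · rw [min_eq_left (a := 4 * t - 1) (by linarith), min_eq_right (by linarith),
        max_eq_right (by linarith)]
  rcases le_total t (3 / 4) with h'' | h''
  · refine Or.inr (Or.inr (Or.inl ⟨h', h'', ?_, ?_⟩))
    · rw [min_eq_right (a := 4 * t) (by linarith), min_eq_right (by linarith),
        max_eq_right (by linarith)]
    · rw [min_eq_left (a := 1) (le_min (by linarith) (by linarith)), max_eq_right (by linarith)]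
  · refine Or.inr (Or.inr (Or.inr ⟨h'', ?_, ?_⟩))
    · rw [min_eq_right (a := 4 * t) (by linarith), min_eq_right (by linarith),
        max_eq_left (by linarith)]
    · rw [min_eq_right (a := 4 * t - 1) (by linarith), min_eq_right (by linarith),
        max_eq_right (by linarith)]

theorem squareBoundary_mem_boundary (t : I) : squareBoundary t ∈ Cube.boundary (Fin 2) := by
  rcases squareBoundary_cases t with ⟨-, -, h⟩ | ⟨-, -, h, -⟩ | ⟨-, -, -, h⟩ | ⟨-, h, -⟩
  · exact ⟨1, Or.inl (Subtype.ext h)⟩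
  · exact ⟨0, Or.inr (Subtype.ext h)⟩
  · exact ⟨1, Or.inr (Subtype.ext h)⟩
  · exact ⟨0, Or.inl (Subtype.ext h)⟩

theorem cube_two_ext {x y : I^ Fin 2} (h0 : (x 0 : ℝ) = y 0) (h1 : (x 1 : ℝ) = y 1) : x = y := by
  ext i
  fin_cases i
  · exact h0
  · exact h1

theorem exists_squareBoundary_eq {y : I^ Fin 2} (hy : y ∈ Cube.boundary (Fin 2)) :
    ∃ t, squareBoundary t = y := by
  have a0 := (y 0).2.1
  have a1 := (y 0).2.2
  have b0 := (y 1).2.1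
  have b1 := (y 1).2.2
  obtain ⟨i, hi⟩ := hy
  fin_cases i
  · rcases hi with hi | hi
    · have hi' : (y 0 : ℝ) = 0 := congrArg Subtype.val hi
      refine ⟨⟨1 - y 1 / 4, by linarith, by linarith⟩, cube_two_ext ?_ ?_⟩
      · rw [coe_squareBoundary_zero, hi']
        simp only
        rw [min_eq_right (a := 4 * _) (by linarith), min_eq_right (by linarith),
          max_eq_left (by linarith)]
      · rw [coe_squareBoundary_one]
        simp only
        rw [min_eq_right (a := 4 * _ - 1) (by linarith), min_eq_right (by linarith),
          max_eq_right (by linarith)]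
        ring
    · have hi' : (y 0 : ℝ) = 1 := congrArg Subtype.val hi
      refine ⟨⟨(1 + y 1) / 4, by linarith, by linarith⟩, cube_two_ext ?_ ?_⟩
      · rw [coe_squareBoundary_zero, hi']
        simp only
        rw [min_eq_left (a := 1) (le_min (by linarith) (by linarith)), max_eq_right (by linarith)]
      · rw [coe_squareBoundary_one]
        simp only
        rw [min_eq_left (a := 4 * _ - 1) (by linarith), min_eq_right (by linarith),
          max_eq_right (by linarith)]
        ring
  · rcases hi with hi | hi
    · have hi' : (y 1 : ℝ) = 0 := congrArg Subtype.val hi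
      refine ⟨⟨y 0 / 4, by linarith, by linarith⟩, cube_two_ext ?_ ?_⟩
      · rw [coe_squareBoundary_zero]
        simp only
        rw [min_eq_left (a := 4 * _) (by linarith), min_eq_right (by linarith),
          max_eq_right (by linarith)]
        ring
      · rw [coe_squareBoundary_one, hi']
        simp only
        rw [min_eq_left (a := 4 * _ - 1) (by linarith), min_eq_right (by linarith),
          max_eq_left (by linarith)]
    · have hi' : (y 1 : ℝ) = 1 := congrArg Subtype.val hi
      refine ⟨⟨(3 - y 0) / 4, by linarith, by linarith⟩, cube_two_ext ?_ ?_⟩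
      · rw [coe_squareBoundary_zero]
        simp only
        rw [min_eq_right (a := 4 * _) (by linarith), min_eq_right (by linarith),
          max_eq_right (by linarith)]
        ring
      · rw [coe_squareBoundary_one, hi']
        simp only
        rw [min_eq_left (a := 1) (le_min (by linarith) (by linarith)), max_eq_right (by linarith)]

/-- The boundary parametrization of the square is injective up to its two end points. -/
theorem squareBoundary_eq_iff {t u : I} : squareBoundary t = squareBoundary u →
    t = u ∨ (t = 0 ∧ u = 1) ∨ (t = 1 ∧ u = 0) := by
  intro h
  have h0 := congrArg (fun w : I^ Fin 2 => (w 0 : ℝ)) h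
  have h1 := congrArg (fun w : I^ Fin 2 => (w 1 : ℝ)) h
  have ct := squareBoundary_cases t
  have cu := squareBoundary_cases u
  simp only [← h0, ← h1] at cu
  have key : (t : ℝ) = u ∨ ((t : ℝ) = 0 ∧ (u : ℝ) = 1) ∨ ((t : ℝ) = 1 ∧ (u : ℝ) = 0) := by
    have := t.2.1
    have := t.2.2
    have := u.2.1
    have := u.2.2
    clear h h0 h1
    generalize (squareBoundary t 0 : ℝ) = x at *
    generalize (squareBoundary t 1 : ℝ) = y at *
    generalize (t : ℝ) = t at *
    generalize (u : ℝ) = u at *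
    rcases ct with ⟨_, _, _⟩ | ⟨_, _, _, _⟩ | ⟨_, _, _, _⟩ | ⟨_, _, _⟩ <;>
    rcases cu with ⟨_, _, _⟩ | ⟨_, _, _, _⟩ | ⟨_, _, _, _⟩ | ⟨_, _, _⟩ <;> grind
  rcases key with h | ⟨h, h'⟩ | ⟨h, h'⟩
  · exact Or.inl (Subtype.ext h)
  · exact Or.inr (Or.inl ⟨Subtype.ext h, Subtype.ext h'⟩)
  · exact Or.inr (Or.inr ⟨Subtype.ext h, Subtype.ext h'⟩)

theorem squareBoundary_zero : squareBoundary 0 = 0 := by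
  refine cube_two_ext ?_ ?_
  · simp [coe_squareBoundary_zero]
  · simp [coe_squareBoundary_one]

theorem squareBoundary_one : squareBoundary 1 = 0 := by
  refine cube_two_ext ?_ ?_
  · rw [coe_squareBoundary_zero]; norm_num
  · rw [coe_squareBoundary_one]; norm_num

/-- The straight line from `x` to `y` in a cube. -/
def cubeSegment {N : Type*} (x y : I^N) (s : I) : I^N := fun i => Set.Icc.convexComb (x i) (y i) s

theorem coe_cubeSegment {N : Type*} (x y : I^N) (s : I) (i : N) :
    (cubeSegment x y s i : ℝ) = (1 - s) * x i + s * y i := rfl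

@[simp] theorem cubeSegment_zero {N : Type*} (x y : I^N) : cubeSegment x y 0 = x :=
  funext fun i => Set.Icc.convexComb_zero (x i) (y i)

@[simp] theorem cubeSegment_one {N : Type*} (x y : I^N) : cubeSegment x y 1 = y :=
  funext fun i => Set.Icc.convexComb_one (x i) (y i)

@[simp] theorem cubeSegment_self {N : Type*} (x : I^N) (s : I) : cubeSegment x x s = x :=
  funext fun i => Set.Icc.convexComb_eq (x i) s

@[fun_prop]
theorem Continuous.cubeSegment {N Y : Type*} [TopologicalSpace Y] {f h : Y → I^N} {s : Y → I}
    (hf : Continuous f) (hh : Continuous h) (hs : Continuous s) :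
    Continuous fun y => cubeSegment (f y) (h y) (s y) := by
  refine continuous_pi fun i => Continuous.subtype_mk ?_ _
  have hf' : Continuous fun y => f y i := (continuous_apply i).comp hf
  have hh' : Continuous fun y => h y i := (continuous_apply i).comp hh
  fun_prop

/-- The centre of the square. -/
noncomputable def squareCenter : I^ Fin 2 := fun _ => ⟨1 / 2, by norm_num, by norm_num⟩

/-- Polar coordinates on the square: `u` is the boundary parameter and `v` the radius. -/
noncomputable def squarePolar (u v : I) : I^ Fin 2 := cubeSegment squareCenter (squareBoundary u) v

@[fun_prop]
theorem Continuous.squarePolar {Y : Type*} [TopologicalSpace Y] {u v : Y → I}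
    (hu : Continuous u) (hv : Continuous v) : Continuous fun y => squarePolar (u y) (v y) :=
  continuous_const.cubeSegment (continuous_squareBoundary.comp hu) hv

@[simp] theorem squarePolar_one (u : I) : squarePolar u 1 = squareBoundary u := cubeSegment_one _ _

@[simp] theorem squarePolar_zero (u : I) : squarePolar u 0 = squareCenter := cubeSegment_zero _ _

/-- The radius in polar coordinates, i.e. the normalized maximum distance to the centre. -/
noncomputable def squareRadius (w : I^ Fin 2) : ℝ := max |2 * (w 0 : ℝ) - 1| |2 * (w 1 : ℝ) - 1|

theorem squareRadius_eq_one {w : I^ Fin 2} (hw : w ∈ Cube.boundary (Fin 2)) :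
    squareRadius w = 1 := by
  have h : ∀ i, |2 * (w i : ℝ) - 1| ≤ 1 := fun i =>
    abs_le.2 ⟨by linarith [(w i).2.1], by linarith [(w i).2.2]⟩
  obtain ⟨i, hi⟩ := hw
  have h1 : |2 * (w i : ℝ) - 1| = 1 := by
    rcases hi with hi | hi
    · simp [hi]
    · rw [hi]; norm_num
  refine le_antisymm (max_le (h 0) (h 1)) ?_
  unfold squareRadius
  fin_cases i
  · exact h1.symm.le.trans (le_max_left _ _)
  · exact h1.symm.le.trans (le_max_right _ _)

theorem mem_boundary_of_squareRadius {w : I^ Fin 2} (hw : squareRadius w = 1) :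
    w ∈ Cube.boundary (Fin 2) := by
  have key : ∀ i, |2 * (w i : ℝ) - 1| = 1 → w ∈ Cube.boundary (Fin 2) := fun i hi => by
    rcases eq_or_eq_neg_of_abs_eq hi with h | h
    · exact ⟨i, Or.inr (Subtype.ext (by change (w i : ℝ) = 1; linarith))⟩
    · exact ⟨i, Or.inl (Subtype.ext (by change (w i : ℝ) = 0; linarith))⟩
  rcases max_choice |2 * (w 0 : ℝ) - 1| |2 * (w 1 : ℝ) - 1| with h | h
  · exact key 0 (h.symm.trans hw)
  · exact key 1 (h.symm.trans hw)

theorem squareRadius_squarePolar (u v : I) : squareRadius (squarePolar u v) = v := by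
  have h : ∀ i, |2 * (squarePolar u v i : ℝ) - 1| = v * |2 * (squareBoundary u i : ℝ) - 1| := by
    intro i
    rw [squarePolar, coe_cubeSegment, squareCenter, ← abs_of_nonneg v.2.1, ← abs_mul,
      abs_of_nonneg v.2.1]
    congr 1
    ring
  rw [squareRadius, h, h, ← mul_max_of_nonneg _ _ v.2.1]
  exact (congrArg _ (squareRadius_eq_one (squareBoundary_mem_boundary u))).trans (mul_one _)

/-- The identifications made by polar coordinates. -/
theorem squarePolar_eq {u v u' v' : I} (h : squarePolar u v = squarePolar u' v') :
    v = v' ∧ (v = 0 ∨ u = u' ∨ (u = 0 ∧ u' = 1) ∨ (u = 1 ∧ u' = 0)) := by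
  have hv : v = v' := Subtype.ext (by
    rw [← squareRadius_squarePolar u v, h, squareRadius_squarePolar])
  subst hv
  refine ⟨rfl, or_iff_not_imp_left.2 fun h0 => squareBoundary_eq_iff (funext fun i => ?_)⟩
  have h0' : (v : ℝ) ≠ 0 := fun h' => h0 (Subtype.ext h')
  have hi := congrArg Subtype.val (congrFun h i)
  simp only [squarePolar, coe_cubeSegment] at hi
  exact Subtype.ext (mul_left_cancel₀ h0' (add_left_cancel hi))

theorem squarePolar_surjective : Function.Surjective fun y : I × I => squarePolar y.1 y.2 := by
  intro w
  have hr : ∀ i, |2 * (w i : ℝ) - 1| ≤ squareRadius w := by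
    intro i
    fin_cases i
    · exact le_max_left _ _
    · exact le_max_right _ _
  have hr0 : 0 ≤ squareRadius w := (abs_nonneg _).trans (hr 0)
  have hr1 : squareRadius w ≤ 1 := by
    refine max_le ?_ ?_ <;> rw [abs_le] <;> constructor <;>
      linarith [(w 0).2.1, (w 0).2.2, (w 1).2.1, (w 1).2.2]
  rcases hr0.eq_or_lt with h | h
  · refine ⟨(0, 0), funext fun i => Subtype.ext ?_⟩
    have := hr i
    rw [← h, abs_nonpos_iff] at this
    simp only [squarePolar_zero, squareCenter]
    linarith
  · let y : I^ Fin 2 := fun i => ⟨1 / 2 + (2 * w i - 1) / (2 * squareRadius w), by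
      have h2 := abs_le.1 (hr i)
      have : -(1 / 2) ≤ (2 * (w i : ℝ) - 1) / (2 * squareRadius w) := by
        rw [le_div_iff₀ (by linarith)]; linarith
      have : (2 * (w i : ℝ) - 1) / (2 * squareRadius w) ≤ 1 / 2 := by
        rw [div_le_iff₀ (by linarith)]; linarith
      constructor <;> linarith⟩
    have hy : ∀ i, |2 * (y i : ℝ) - 1| = |2 * (w i : ℝ) - 1| / squareRadius w := by
      intro i
      rw [eq_div_iff h.ne']
      nth_rw 1 [← abs_of_pos h]
      rw [← abs_mul]
      congr 1
      simp only [y]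
      field_simp
      ring
    have hyb : y ∈ Cube.boundary (Fin 2) := by
      refine mem_boundary_of_squareRadius ?_
      rw [squareRadius, hy, hy, max_div_div_right h.le]
      exact div_self h.ne'
    obtain ⟨u, hu⟩ := exists_squareBoundary_eq hyb
    refine ⟨(u, ⟨squareRadius w, hr0, hr1⟩), funext fun i => Subtype.ext ?_⟩
    simp only [squarePolar, coe_cubeSegment, hu, squareCenter, y]
    field_simp
    ring

theorem isQuotientMap_squarePolar :
    Topology.IsQuotientMap fun y : I × I => squarePolar y.1 y.2 := by
  have hc : Continuous fun y : I × I => squarePolar y.1 y.2 := by fun_prop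
  exact hc.isClosedMap.isQuotientMap hc squarePolar_surjective

/-- The function on the square given by `Φ` in polar coordinates. It is meaningful if `Φ u v` is
independent of `u` for `v = 0` and agrees for `u = 0` and `u = 1`; in general, it is evaluated at
some choice of polar coordinates. -/
noncomputable def ofPolar {Y : Type*} (Φ : I → I → Y) (w : I^ Fin 2) : Y :=
  Φ (Function.surjInv squarePolar_surjective w).1 (Function.surjInv squarePolar_surjective w).2

theorem ofPolar_squarePolar {Y : Type*} {Φ : I → I → Y} (h0 : ∀ u u', Φ u 0 = Φ u' 0)
    (h1 : ∀ v, Φ 0 v = Φ 1 v) (u v : I) : ofPolar Φ (squarePolar u v) = Φ u v := by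
  unfold ofPolar
  have h := squarePolar_eq (Function.surjInv_eq squarePolar_surjective (squarePolar u v))
  generalize Function.surjInv squarePolar_surjective (squarePolar u v) = y at h
  obtain ⟨rfl, h⟩ := h
  rcases h with h | rfl | ⟨h, rfl⟩ | ⟨h, rfl⟩
  · rw [h]
    exact h0 _ _
  · rfl
  · rw [h, h1]
  · rw [h, h1]

theorem continuous_ofPolar {Y Z : Type*} [TopologicalSpace Y] [TopologicalSpace Z]
    [LocallyCompactSpace Z] {Φ : Z → I → I → Y}
    (hΦ : Continuous fun y : Z × (I × I) => Φ y.1 y.2.1 y.2.2)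
    (h0 : ∀ z u u', Φ z u 0 = Φ z u' 0) (h1 : ∀ z v, Φ z 0 v = Φ z 1 v) :
    Continuous fun y : Z × (I^ Fin 2) => ofPolar (Φ y.1) y.2 := by
  refine isQuotientMap_squarePolar.continuous_lift_prod_right ?_
  convert hΦ using 2 with y
  exact ofPolar_squarePolar (h0 _) (h1 _) _ _

end Polar

/-! ### A map of degree one from the square to itself -/

section Degree

@[fun_prop]
theorem Continuous.cubeAppend {m n : ℕ} {Y : Type*} [TopologicalSpace Y] {f : Y → I^ Fin m}
    {h : Y → I^ Fin n} (hf : Continuous f) (hh : Continuous h) :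
    Continuous fun y => (Fin.append (f y) (h y) : I^ Fin (m + n)) := by
  refine continuous_pi fun i => ?_
  induction i using Fin.addCases with
  | left i =>
    have : Continuous fun y => f y i := (continuous_apply i).comp hf
    simpa using this
  | right i =>
    have : Continuous fun y => h y i := (continuous_apply i).comp hh
    simpa using this

theorem Cube.append_mem_boundary_iff {m n : ℕ} {z : I^ Fin m} {w : I^ Fin n} :
    (Fin.append z w : I^ Fin (m + n)) ∈ Cube.boundary (Fin (m + n)) ↔
      z ∈ Cube.boundary (Fin m) ∨ w ∈ Cube.boundary (Fin n) := by
  constructor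
  · rintro ⟨i, hi⟩
    induction i using Fin.addCases with
    | left i => exact Or.inl ⟨i, by simpa using hi⟩
    | right i => exact Or.inr ⟨i, by simpa using hi⟩
  · rintro (⟨i, hi⟩ | ⟨i, hi⟩)
    · exact ⟨Fin.castAdd n i, by simpa using hi⟩
    · exact ⟨Fin.natAdd m i, by simpa using hi⟩

theorem Cube.append_castAdd_natAdd {m n : ℕ} (y : I^ Fin (m + n)) :
    Fin.append (fun i => y (Fin.castAdd n i)) (fun j => y (Fin.natAdd m j)) = y :=
  Fin.append_castAdd_natAdd

/-- The boundary of the square together with the segment from the centre to the corner `(0, 0)`. -/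
def squareCut : Set (I^ Fin 2) := {w | w ∈ Cube.boundary (Fin 2) ∨ ∃ v, w = squarePolar 0 v}

variable {X : Type*} [TopologicalSpace X] {x : X} {n : ℕ}

/-- Composition of the last two variables of a map of the cube, which sends `squareCut` to the base
point, with a self-map of the square. -/
def GenLoop.compSquare (h : Ω^ (Fin (n + 2)) X x)
    (hD : ∀ z, ∀ w ∈ squareCut, h (Fin.append z w : I^ Fin (n + 2)) = x)
    (f : C(I^ Fin 2, I^ Fin 2)) (hf : ∀ w ∈ Cube.boundary (Fin 2), f w ∈ squareCut) :
    Ω^ (Fin (n + 2)) X x :=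
  ⟨⟨fun y => h (Fin.append (fun i => y (Fin.castAdd 2 i)) (f fun j => y (Fin.natAdd n j)) :
    I^ Fin (n + 2)), by fun_prop⟩, fun y hy => by
      rw [← Cube.append_castAdd_natAdd y, Cube.append_mem_boundary_iff] at hy
      rcases hy with hy | hy
      · exact h.2 _ (Cube.append_mem_boundary_iff.2 (Or.inl hy))
      · exact hD _ _ (hf _ hy)⟩

theorem GenLoop.compSquare_homotopic {h : Ω^ (Fin (n + 2)) X x}
    {hD : ∀ z, ∀ w ∈ squareCut, h (Fin.append z w : I^ Fin (n + 2)) = x}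
    {f f' : C(I^ Fin 2, I^ Fin 2)} {hf : ∀ w ∈ Cube.boundary (Fin 2), f w ∈ squareCut}
    {hf' : ∀ w ∈ Cube.boundary (Fin 2), f' w ∈ squareCut}
    (T : C(I × (I^ Fin 2), I^ Fin 2)) (h0 : ∀ w, T (0, w) = f w) (h1 : ∀ w, T (1, w) = f' w)
    (hT : ∀ s, ∀ w ∈ Cube.boundary (Fin 2), T (s, w) ∈ squareCut) :
    GenLoop.Homotopic (GenLoop.compSquare h hD f hf) (GenLoop.compSquare h hD f' hf') := by
  rw [GenLoop.homotopic_iff]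
  refine ⟨⟨fun y => h (Fin.append (fun i => y.2 (Fin.castAdd 2 i))
    (T (y.1, fun j => y.2 (Fin.natAdd n j))) : I^ Fin (n + 2)), by fun_prop⟩, fun z => ?_,
    fun z => ?_, fun t y hy => ?_⟩
  · simp only [ContinuousMap.coe_mk, h0]
    rfl
  · simp only [ContinuousMap.coe_mk, h1]
    rfl
  · rw [← Cube.append_castAdd_natAdd y, Cube.append_mem_boundary_iff] at hy
    rcases hy with hy | hy
    · exact h.2 _ (Cube.append_mem_boundary_iff.2 (Or.inl hy))
    · exact hD _ _ (hT _ _ hy)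

/-- The cone over a homotopy of closed curves in the square, with apex the centre. -/
noncomputable def squareCone (B : C(I × I, I^ Fin 2)) (hB : ∀ s, B (s, 0) = B (s, 1)) :
    C(I × (I^ Fin 2), I^ Fin 2) :=
  ⟨fun y => ofPolar (fun t r => cubeSegment squareCenter (B (y.1, t)) r) y.2, by
    refine continuous_ofPolar (Φ := fun s t r => cubeSegment squareCenter (B (s, t)) r) ?_ ?_ ?_
    · fun_prop
    · simp
    · simp [hB]⟩

theorem squareCone_squarePolar {B : C(I × I, I^ Fin 2)} (hB : ∀ s, B (s, 0) = B (s, 1))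
    (s t r : I) :
    squareCone B hB (s, squarePolar t r) = cubeSegment squareCenter (B (s, t)) r :=
  ofPolar_squarePolar (Φ := fun t r => cubeSegment squareCenter (B (s, t)) r)
    (by simp) (by simp [hB]) t r

theorem squareCone_squareBoundary {B : C(I × I, I^ Fin 2)} (hB : ∀ s, B (s, 0) = B (s, 1))
    (s t : I) : squareCone B hB (s, squareBoundary t) = B (s, t) := by
  rw [← squarePolar_one, squareCone_squarePolar, cubeSegment_one]

/-- The boundary parameter stretched so that it runs along the second side only. -/
noncomputable def stretch (t : I) : I := Set.projIcc 0 1 zero_le_one (4 * (t : ℝ) - 1)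

@[fun_prop]
theorem continuous_stretch : Continuous stretch :=
  (continuous_projIcc (h := zero_le_one)).comp (f := fun t : I => 4 * (t : ℝ) - 1) (by fun_prop)

theorem stretch_of_le {t : I} (h : (t : ℝ) ≤ 1 / 4) : stretch t = 0 :=
  Set.projIcc_of_le_left _ (by linarith)

theorem stretch_of_ge {t : I} (h : 1 / 2 ≤ (t : ℝ)) : stretch t = 1 :=
  Set.projIcc_of_right_le _ (by linarith)

theorem squarePolar_one_left (v : I) : squarePolar 1 v = squarePolar 0 v := by
  rw [squarePolar, squarePolar, squareBoundary_zero, squareBoundary_one]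

theorem squareBoundary_mem_squareCut (t : I) : squareBoundary t ∈ squareCut :=
  Or.inl (squareBoundary_mem_boundary t)

/-- Polar coordinates define a self-map of the square of degree one. Since its boundary is mapped
to `squareCut` only, this is formulated for maps of the cube which are constant on `squareCut`. -/
theorem GenLoop.homotopic_comp_squarePolar (h h' : Ω^ (Fin (n + 2)) X x)
    (hD : ∀ (z : I^ Fin n) v, h (Fin.append z (squarePolar 0 v) : I^ Fin (n + 2)) = x)
    (hh' : ∀ (z : I^ Fin n) w, h' (Fin.append z w : I^ Fin (n + 2)) =
      h (Fin.append z (squarePolar (w 1) (w 0)) : I^ Fin (n + 2))) :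
    GenLoop.Homotopic h' h := by
  have hD' : ∀ z, ∀ w ∈ squareCut, h (Fin.append z w : I^ Fin (n + 2)) = x := by
    rintro z w (hw | ⟨v, rfl⟩)
    · exact h.2 _ (Cube.append_mem_boundary_iff.2 (Or.inr hw))
    · exact hD z v
  -- The first homotopy turns the boundary curve so that it runs through the boundary on the
  -- second side of the square and stays at the corner elsewhere.
  let B : C(I × I, I^ Fin 2) :=
    ⟨fun y => squareBoundary (Set.Icc.convexComb y.2 (stretch y.2) y.1), by
      refine continuous_squareBoundary.comp (Continuous.subtype_mk ?_ _)
      fun_prop⟩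
  have s0 : stretch 0 = 0 := stretch_of_le (by norm_num)
  have s1 : stretch 1 = 1 := stretch_of_ge (by norm_num)
  have hB : ∀ s, B (s, 0) = B (s, 1) := fun s => by
    simp [B, s0, s1, squareBoundary_zero, squareBoundary_one]
  -- The second one moves the corner to the centre along the diagonal, as far as needed to agree
  -- with polar coordinates on the boundary.
  let B' : C(I × I, I^ Fin 2) :=
    ⟨fun y => squarePolar (stretch y.2) (max (squareBoundary y.2 0) (unitInterval.symm y.1)), by
      have : Continuous fun y : I × I => squareBoundary y.2 0 :=
        (continuous_apply 0).comp (continuous_squareBoundary.comp continuous_snd)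
      fun_prop⟩
  have hB' : ∀ s, B' (s, 0) = B' (s, 1) := fun s => by
    simp [B', s0, s1, squareBoundary_zero, squareBoundary_one, squarePolar_one_left]
  have hB'D : ∀ s t, B' (s, t) ∈ squareCut := by
    intro s t
    rcases squareBoundary_cases t with ⟨ht, -, -⟩ | ⟨-, -, ht, -⟩ | ⟨ht, -, -, -⟩ | ⟨ht, -, -⟩
    · exact Or.inr ⟨_, by simp only [B', ContinuousMap.coe_mk, stretch_of_le ht]; rfl⟩
    · have : squareBoundary t 0 = 1 := Subtype.ext ht
      have hm : max (1 : I) (unitInterval.symm s) = 1 := max_eq_left unitInterval.le_one'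
      simp only [B', ContinuousMap.coe_mk, this, hm, squarePolar_one]
      exact squareBoundary_mem_squareCut _
    · refine Or.inr ⟨max (squareBoundary t 0) (unitInterval.symm s), ?_⟩
      simp only [B', ContinuousMap.coe_mk, stretch_of_ge ht, squarePolar_one_left]
    · refine Or.inr ⟨max (squareBoundary t 0) (unitInterval.symm s), ?_⟩
      simp only [B', ContinuousMap.coe_mk, stretch_of_ge (t := t) (by linarith),
        squarePolar_one_left]
  have hB'1 : ∀ t, B' (1, t) = squarePolar (squareBoundary t 1) (squareBoundary t 0) := by
    intro t
    have h1 : B' (1, t) = squarePolar (stretch t) (squareBoundary t 0) := by simp [B']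
    rw [h1]
    rcases squareBoundary_cases t with ⟨ht, -, h⟩ | ⟨ht, ht', -, h⟩ | ⟨ht, -, -, h⟩ | ⟨-, h, -⟩
    · rw [stretch_of_le ht, show squareBoundary t 1 = 0 from Subtype.ext h]
    · congr 1
      refine Subtype.ext ?_
      rw [h, stretch, Set.projIcc_of_mem zero_le_one ⟨by linarith, by linarith⟩]
    · rw [stretch_of_ge ht, show squareBoundary t 1 = 1 from Subtype.ext h]
    · rw [show squareBoundary t 0 = 0 from Subtype.ext h, squarePolar_zero, squarePolar_zero]
  let polar : C(I^ Fin 2, I^ Fin 2) := ⟨fun w => squarePolar (w 1) (w 0), by fun_prop⟩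
  have of_bd : ∀ {f : (I^ Fin 2) → I^ Fin 2}, (∀ t, f (squareBoundary t) ∈ squareCut) →
      ∀ w ∈ Cube.boundary (Fin 2), f w ∈ squareCut := by
    intro f hf w hw
    obtain ⟨t, rfl⟩ := exists_squareBoundary_eq hw
    exact hf t
  let T : C(I × (I^ Fin 2), I^ Fin 2) :=
    ⟨fun y => cubeSegment (squareCone B' hB' (1, y.2)) (polar y.2) y.1, by fun_prop⟩
  have hT : ∀ s t, T (s, squareBoundary t) = B' (1, t) := by
    intro s t
    simp only [T, ContinuousMap.coe_mk, squareCone_squareBoundary, polar, ← hB'1,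
      cubeSegment_self]
  have c0 : ∀ s, ∀ w ∈ Cube.boundary (Fin 2), squareCone B hB (s, w) ∈ squareCut := fun s =>
    of_bd (f := fun w => squareCone B hB (s, w)) fun t => by
      rw [squareCone_squareBoundary]
      exact squareBoundary_mem_squareCut _
  have c1 : ∀ s, ∀ w ∈ Cube.boundary (Fin 2), squareCone B' hB' (s, w) ∈ squareCut := fun s =>
    of_bd (f := fun w => squareCone B' hB' (s, w)) fun t => by
      rw [squareCone_squareBoundary]
      exact hB'D s t
  have c2 : ∀ s, ∀ w ∈ Cube.boundary (Fin 2), T (s, w) ∈ squareCut := fun s =>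
    of_bd (f := fun w => T (s, w)) fun t => by
      rw [hT]
      exact hB'D 1 t
  have cp : ∀ w ∈ Cube.boundary (Fin 2), polar w ∈ squareCut :=
    of_bd fun t => by
      have := hB'D 1 t
      rwa [hB'1] at this
  have e0 : h = GenLoop.compSquare h hD' (ContinuousMap.id _) fun w hw => Or.inl hw := by
    ext y
    refine congrArg h ?_
    exact (Cube.append_castAdd_natAdd y).symm
  have e1 : h' = GenLoop.compSquare h hD' polar cp := by
    ext y
    rw [← Cube.append_castAdd_natAdd y, hh']
    refine congrArg h ?_
    simp [polar]
  have k1 := GenLoop.compSquare_homotopic (h := h) (hD := hD') (f := ContinuousMap.id _)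
    (f' := (squareCone B hB).curry 1)
    (hf := fun w hw => Or.inl hw) (hf' := c0 1) (squareCone B hB) (fun w => by
      obtain ⟨⟨t, r⟩, rfl⟩ := squarePolar_surjective w
      simp only [squareCone_squarePolar]
      simp [B, squarePolar]) (fun _ => rfl) c0
  have k2 := GenLoop.compSquare_homotopic (h := h) (hD := hD')
    (f := (squareCone B hB).curry 1)
    (f' := (squareCone B' hB').curry 1)
    (hf := c0 1) (hf' := c1 1) (squareCone B' hB') (fun w => by
      obtain ⟨⟨t, r⟩, rfl⟩ := squarePolar_surjective w
      have hm : max (squareBoundary t 0) 1 = 1 := max_eq_right unitInterval.le_one'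
      simp only [squareCone_squarePolar, ContinuousMap.curry_apply]
      simp [B, B', hm]) (fun _ => rfl) c1
  have k3 := GenLoop.compSquare_homotopic (h := h) (hD := hD')
    (f := (squareCone B' hB').curry 1)
    (f' := polar) (hf := c1 1) (hf' := cp) T (fun w => by simp [T]) (fun w => by simp [T]) c2
  rw [← e0] at k1
  rw [e1]
  exact ((k1.trans k2).trans k3).symm

end Degree

/-! ### Gauge transformations as functions on the square -/

section SideIdentifications

variable {X : Type*} [TopologicalSpace X] {g : ℕ} {q : C(I^ Fin 2, X)}

theorem SideRel.exists_squareBoundary {w w' : I^ Fin 2} (h : SideRel g w w') :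
    ∃ t u, w = squareBoundary t ∧ w' = squareBoundary u := by
  cases h with
  | a i s => exact ⟨_, _, rfl, rfl⟩
  | b i s => exact ⟨_, _, rfl, rfl⟩
  | collapse h t u => exact ⟨_, _, rfl, rfl⟩

/-- Distinct points of the square are identified on the surface only if they lie on the
boundary. -/
theorem IsSurfacePresentation.eq_or_exists (hq : IsSurfacePresentation g q) {w w' : I^ Fin 2}
    (h : q w = q w') : w = w' ∨ ∃ t u, w = squareBoundary t ∧ w' = squareBoundary u := by
  rw [hq.eq_iff] at h
  induction h with
  | rel x y h => exact Or.inr h.exists_squareBoundary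
  | refl x => exact Or.inl rfl
  | symm x y _ ih =>
    rcases ih with h | ⟨t, u, h, h'⟩
    · exact Or.inl h.symm
    · exact Or.inr ⟨u, t, h', h⟩
  | trans x y z _ _ ih ih' =>
    rcases ih with rfl | ⟨t, u, h, h'⟩
    · exact ih'
    · rcases ih' with rfl | ⟨t', u', h'', h'''⟩
      · exact Or.inr ⟨t, u, h, h'⟩
      · exact Or.inr ⟨t, u', h, h'''⟩

/-- A function of the boundary parameter which agrees on paired sides descends to the
`1`-skeleton of the surface. -/
theorem IsSurfacePresentation.eq_of_sides (hq : IsSurfacePresentation g q) {α : Type*} {f : I → α}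
    (h01 : f 0 = f 1)
    (ha : ∀ (i : Fin g) s, f (arcParam g (4 * i) s) =
      f (arcParam g (4 * i + 2) (unitInterval.symm s)))
    (hb : ∀ (i : Fin g) s, f (arcParam g (4 * i + 1) s) =
      f (arcParam g (4 * i + 3) (unitInterval.symm s)))
    (h0 : g = 0 → ∀ t u, f t = f u) {t u : I}
    (h : q (squareBoundary t) = q (squareBoundary u)) : f t = f u := by
  classical
  let ψ : (I^ Fin 2) → Option α := fun w =>
    if h : ∃ t, squareBoundary t = w then some (f h.choose) else none
  have hψ : ∀ t, ψ (squareBoundary t) = some (f t) := by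
    intro t
    have ht : ∃ u, squareBoundary u = squareBoundary t := ⟨t, rfl⟩
    simp only [ψ, dif_pos ht, Option.some.injEq]
    rcases squareBoundary_eq_iff ht.choose_spec with h | ⟨h, h'⟩ | ⟨h, h'⟩
    · rw [h]
    · rw [h, h', h01]
    · rw [h, h', h01]
  have key : ψ (squareBoundary t) = ψ (squareBoundary u) := by
    rw [hq.eq_iff] at h
    generalize squareBoundary t = w at h
    generalize squareBoundary u = w' at h
    induction h with
    | rel x y h =>
      cases h with
      | a i s => rw [hψ, hψ, ha]
      | b i s => rw [hψ, hψ, hb]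
      | collapse hg t u => rw [hψ, hψ, h0 hg t u]
    | refl x => rfl
    | symm x y _ ih => exact ih.symm
    | trans x y z _ _ ih ih' => exact ih.trans ih'
  rw [hψ, hψ] at key
  exact Option.some.inj key

end SideIdentifications

/-- Multiplication in `C(Y, K)` is continuous for the compact-open topology: this is the topology of
uniform convergence on compact sets, so that pairs of maps form a continuous map to `C(Y, K × K)`,
which is followed by composition with the multiplication. -/
theorem ContinuousMap.isTopologicalGroup (K Y : Type*) [Group K] [TopologicalSpace K]
    [IsTopologicalGroup K] [TopologicalSpace Y] : IsTopologicalGroup C(Y, K) := by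
  let : UniformSpace K := IsTopologicalGroup.rightUniformSpace K
  have h : Continuous fun y : C(Y, K) × C(Y, K) => y.1.prodMk y.2 := by
    rw [continuous_iff_continuousAt]
    rintro ⟨f, f'⟩
    rw [ContinuousAt, ContinuousMap.tendsto_iff_forall_isCompact_tendstoUniformlyOn,
      nhds_prod_eq]
    exact fun C hC =>
      (ContinuousMap.tendsto_iff_forall_isCompact_tendstoUniformlyOn.mp
        Filter.tendsto_id C hC).prodMk
        (ContinuousMap.tendsto_iff_forall_isCompact_tendstoUniformlyOn.mp Filter.tendsto_id C hC)
  exact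
    { continuous_mul :=
        (ContinuousMap.continuous_postcomp ⟨fun y : K × K => y.1 * y.2, continuous_mul⟩).comp h
      continuous_inv := ContinuousMap.continuous_postcomp ⟨fun k : K => k⁻¹, continuous_inv⟩ }

instance gaugeGroup.isTopologicalGroup {K P : Type*} [Group K] [TopologicalSpace K]
    [IsTopologicalGroup K] [TopologicalSpace P] [MulAction Kᵐᵒᵖ P] :
    IsTopologicalGroup (gaugeGroup K P) :=
  have := ContinuousMap.isTopologicalGroup K P
  inferInstance

section GaugeExtension

variable {K P X : Type*} [Group K] [TopologicalSpace K] [TopologicalSpace P]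
  [TopologicalSpace X] [MulAction Kᵐᵒᵖ P] {q : C(I^ Fin 2, X)} {η : P → X} {g : ℕ}

theorem IsPrincipalBundle.trivialization_smul (hη : IsPrincipalBundle K η)
    {e : Bundle.Trivialization K η}
    (he : ∀ p ∈ e.source, ∀ k : K, (e (op k • p)).2 = (e p).2 * k) {p : P} (hp : p ∈ e.source)
    (k : K) : op k • p ∈ e.source ∧ e (op k • p) = (η p, (e p).2 * k) := by
  have h : op k • p ∈ e.source := by
    rw [e.mem_source, hη.proj_smul, ← e.mem_source]
    exact hp
  exact ⟨h, Prod.ext ((e.coe_fst h).trans (hη.proj_smul k p)) (he p hp k)⟩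

theorem IsPrincipalBundle.exists_smul_eq (hη : IsPrincipalBundle K η) {p p' : P}
    (h : η p = η p') : ∃ k : K, op k • p = p' := by
  obtain ⟨e, hx, he⟩ := hη.locally_trivial (η p)
  have hp : p ∈ e.source := e.mem_source.2 hx
  have hp' : p' ∈ e.source := e.mem_source.2 (h ▸ hx)
  obtain ⟨h1, h2⟩ := hη.trivialization_smul he hp ((e p).2⁻¹ * (e p').2)
  refine ⟨_, e.injOn h1 hp' (h2.trans (Prod.ext (h.trans (e.coe_fst hp').symm) ?_))⟩
  exact mul_inv_cancel_left _ _

theorem IsPrincipalBundle.smul_injective (hη : IsPrincipalBundle K η) {p : P} {k k' : K}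
    (h : op k • p = op k' • p) : k = k' := by
  obtain ⟨e, hx, he⟩ := hη.locally_trivial (η p)
  have hp : p ∈ e.source := e.mem_source.2 hx
  have := congrArg (fun x => (e x).2) h
  simp only [he p hp] at this
  exact mul_left_cancel this

namespace CharacteristicMap

variable (T : CharacteristicMap K q η)

/-- The condition for a function on the square to be of the form `w ↦ f (T.lift w)` for a gauge
transformation `f`: on the boundary, the function obtained from it by passing from `T.lift` to
`T.skeletonSection` descends to the `1`-skeleton. -/
def Compatible (F : (I^ Fin 2) → K) : Prop :=
  ∀ t u : I, q (squareBoundary t) = q (squareBoundary u) →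
    (T.loop fun _ => t)⁻¹ * F (squareBoundary t) * (T.loop fun _ => t) =
      (T.loop fun _ => u)⁻¹ * F (squareBoundary u) * (T.loop fun _ => u)

open Classical in
/-- The equivariant function on `P` with values `F w` at `T.lift w`, for compatible `F`. -/
noncomputable def gaugeExt (F : (I^ Fin 2) → K) (p : P) : K :=
  if h : ∃ y : (I^ Fin 2) × K, op y.2 • T.lift y.1 = p then
    h.choose.2⁻¹ * F h.choose.1 * h.choose.2 else 1

variable {T}

theorem gaugeExt_smul_lift (hq : IsSurfacePresentation g q) (hη : IsPrincipalBundle K η)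
    {F : (I^ Fin 2) → K} (hF : T.Compatible F) (k : K) (w : I^ Fin 2) :
    T.gaugeExt F (op k • T.lift w) = k⁻¹ * F w * k := by
  have h : ∃ y : (I^ Fin 2) × K, op y.2 • T.lift y.1 = op k • T.lift w := ⟨(w, k), rfl⟩
  rw [gaugeExt, dif_pos h]
  have h' := h.choose_spec
  generalize h.choose = y at h'
  obtain ⟨w', k'⟩ := y
  simp only at h' ⊢
  have hw : q w' = q w := by
    rw [← T.proj_lift, ← T.proj_lift, ← hη.proj_smul k', h', hη.proj_smul]
  rcases hq.eq_or_exists hw with rfl | ⟨t, u, rfl, rfl⟩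
  · rw [hη.smul_injective h']
  · have hs := T.compat t u hw
    have hf := hF t u hw
    set γt := T.loop fun _ => t
    set γu := T.loop fun _ => u
    have hk : k = γu * γt⁻¹ * k' := by
      refine (hη.smul_injective (p := T.lift (squareBoundary u)) ?_).symm
      rw [← h', mul_assoc, ← op_smul_op_smul, ← hs, op_smul_op_smul, mul_inv_cancel_left]
    have hFt : F (squareBoundary t) =
        γt * (γu⁻¹ * F (squareBoundary u) * γu) * γt⁻¹ := by
      rw [← hf]
      group
    rw [hFt, hk]
    group

theorem exists_smul_lift (hq : IsSurfacePresentation g q) (hη : IsPrincipalBundle K η)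
    (T : CharacteristicMap K q η) (p : P) : ∃ (k : K) (w : I^ Fin 2), op k • T.lift w = p := by
  obtain ⟨w, hw⟩ := hq.isQuotientMap.surjective (η p)
  obtain ⟨k, hk⟩ := hη.exists_smul_eq ((T.proj_lift w).trans hw)
  exact ⟨k, w, hk⟩

theorem gaugeExt_smul (hq : IsSurfacePresentation g q) (hη : IsPrincipalBundle K η)
    {F : (I^ Fin 2) → K} (hF : T.Compatible F) (p : P) (k : K) :
    T.gaugeExt F (op k • p) = k⁻¹ * T.gaugeExt F p * k := by
  obtain ⟨k', w, rfl⟩ := exists_smul_lift hq hη T p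
  rw [op_smul_op_smul, gaugeExt_smul_lift hq hη hF, gaugeExt_smul_lift hq hη hF]
  group

theorem gaugeExt_lift (hq : IsSurfacePresentation g q) (hη : IsPrincipalBundle K η)
    {F : (I^ Fin 2) → K} (hF : T.Compatible F) (w : I^ Fin 2) :
    T.gaugeExt F (T.lift w) = F w := by
  simpa using gaugeExt_smul_lift hq hη hF 1 w

/-- The extension is jointly continuous in `p` and in parameters from a locally compact space.
Over a trivializing open set `U`, it is determined by its restriction to a section, which is a
function on `U` and hence can be tested for continuity on the open part `q ⁻¹' U` of the square. -/
theorem continuous_gaugeExt [IsTopologicalGroup K] (hq : IsSurfacePresentation g q)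
    (hη : IsPrincipalBundle K η) {Z : Type*} [TopologicalSpace Z] [LocallyCompactSpace Z]
    {F : Z → (I^ Fin 2) → K} (hF : Continuous fun y : Z × (I^ Fin 2) => F y.1 y.2)
    (hc : ∀ z, T.Compatible (F z)) :
    Continuous fun y : Z × P => T.gaugeExt (F y.1) y.2 := by
  rw [continuous_iff_continuousAt]
  rintro ⟨z₀, p₀⟩
  obtain ⟨e, hx, he⟩ := hη.locally_trivial (η p₀)
  let τ : e.baseSet → P := fun x => e.toOpenPartialHomeomorph.symm (x, 1)
  have hmem : ∀ x : e.baseSet, ((x : X), (1 : K)) ∈ e.target := fun x => e.mem_target.2 x.2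
  have hτs : ∀ x, τ x ∈ e.source := fun x => e.map_target (hmem x)
  have hτe : ∀ x : e.baseSet, e (τ x) = ((x : X), (1 : K)) := fun x => e.right_inv (hmem x)
  have hτη : ∀ x : e.baseSet, η (τ x) = x := fun x => by
    rw [← e.coe_fst (hτs x), hτe]
  -- every point over `U` is obtained from the section by the action of its second coordinate
  have hτp : ∀ (p : P) (hp : η p ∈ e.baseSet), op (e p).2 • τ ⟨η p, hp⟩ = p := by
    intro p hp
    obtain ⟨h1, h2⟩ := hη.trivialization_smul he (hτs ⟨η p, hp⟩) (e p).2
    refine e.injOn h1 (e.mem_source.2 hp) (h2.trans (Prod.ext ?_ ?_))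
    · exact (hτη ⟨η p, hp⟩).trans (e.coe_fst (e.mem_source.2 hp)).symm
    · exact (congrArg (fun x => x.2 * (e p).2) (hτe ⟨η p, hp⟩)).trans (one_mul _)
  have hec : ContinuousOn (fun p => (e p).2) e.source :=
    continuous_snd.comp_continuousOn e.continuousOn_toFun
  have hsec : Continuous fun y : Z × e.baseSet => T.gaugeExt (F y.1) (τ y.2) := by
    refine (hq.isQuotientMap.restrictPreimage_isOpen e.open_baseSet).continuous_lift_prod_right ?_
    have hk : Continuous fun w : q ⁻¹' e.baseSet => (e (T.lift w)).2 := by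
      refine hec.comp_continuous (T.lift.continuous.comp continuous_subtype_val) fun w => ?_
      rw [e.mem_source, T.proj_lift]
      exact w.2
    have hk' : ∀ (z : Z) (w : q ⁻¹' e.baseSet),
        T.gaugeExt (F z) (τ (e.baseSet.restrictPreimage q w)) =
          (e (T.lift w)).2 * F z w * (e (T.lift w)).2⁻¹ := by
      intro z w
      have hw : η (T.lift w) ∈ e.baseSet := by
        rw [T.proj_lift]
        exact w.2
      have h1 := hτp (T.lift w) hw
      have h2 : (⟨η (T.lift w), hw⟩ : e.baseSet) = e.baseSet.restrictPreimage q w :=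
        Subtype.ext (T.proj_lift _)
      rw [h2] at h1
      rw [← gaugeExt_lift hq hη (hc z) w]
      conv_rhs => rw [← h1, gaugeExt_smul hq hη (hc z), h1]
      group
    have hFc : Continuous fun y : Z × (q ⁻¹' e.baseSet) => F y.1 y.2 :=
      hF.comp (continuous_fst.prodMk (continuous_subtype_val.comp continuous_snd))
    have hkc := hk.comp (continuous_snd (X := Z))
    exact ((hkc.mul hFc).mul hkc.inv).congr fun y => (hk' y.1 y.2).symm
  have hopen : IsOpen {y : Z × P | y.2 ∈ e.source} := e.open_source.preimage continuous_snd
  refine ContinuousOn.continuousAt (s := {y : Z × P | y.2 ∈ e.source}) ?_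
    (hopen.mem_nhds (e.mem_source.2 hx))
  rw [continuousOn_iff_continuous_domRestrict]
  have hη' : Continuous fun y : {y : Z × P | y.2 ∈ e.source} =>
      (⟨η y.1.2, e.mem_source.1 y.2⟩ : e.baseSet) :=
    Continuous.subtype_mk (e.continuousOn_proj.comp_continuous (by fun_prop) fun y => y.2) _
  have he' : Continuous fun y : {y : Z × P | y.2 ∈ e.source} => (e y.1.2).2 :=
    hec.comp_continuous (continuous_snd.comp continuous_subtype_val) fun y => y.2
  have h1 := hsec.comp ((continuous_fst.comp continuous_subtype_val).prodMk hη')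
  refine ((he'.inv.mul h1).mul he').congr fun y => ?_
  have h2 := hτp y.1.2 (e.mem_source.1 y.2)
  have h3 := gaugeExt_smul hq hη (hc y.1.1) (τ ⟨η y.1.2, e.mem_source.1 y.2⟩) (e y.1.2).2
  rw [h2] at h3
  exact h3.symm

/-- A compatible family of functions on the square defines a family of gauge transformations. -/
noncomputable def gaugeFamily [IsTopologicalGroup K] (hq : IsSurfacePresentation g q)
    (hη : IsPrincipalBundle K η) {Z : Type*} [TopologicalSpace Z] [LocallyCompactSpace Z]
    (F : Z → (I^ Fin 2) → K) (hF : Continuous fun y : Z × (I^ Fin 2) => F y.1 y.2)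
    (hc : ∀ z, T.Compatible (F z)) : C(Z, gaugeGroup K P) where
  toFun z := ⟨⟨T.gaugeExt (F z), (continuous_gaugeExt hq hη hF hc).comp
    (continuous_const.prodMk continuous_id)⟩, gaugeExt_smul hq hη (hc z)⟩
  continuous_toFun := Continuous.subtype_mk
    (ContinuousMap.curry ⟨_, continuous_gaugeExt hq hη hF hc⟩).continuous _

theorem gaugeFamily_lift [IsTopologicalGroup K] (hq : IsSurfacePresentation g q)
    (hη : IsPrincipalBundle K η) {Z : Type*} [TopologicalSpace Z] [LocallyCompactSpace Z]
    {F : Z → (I^ Fin 2) → K} (hF : Continuous fun y : Z × (I^ Fin 2) => F y.1 y.2)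
    (hc : ∀ z, T.Compatible (F z)) (z : Z) (w : I^ Fin 2) :
    (gaugeFamily hq hη F hF hc z).1 (T.lift w) = F z w :=
  gaugeExt_lift hq hη (hc z) w

/-- A gauge transformation is determined by its values on the lift of the square. -/
theorem gauge_ext [IsTopologicalGroup K] (hq : IsSurfacePresentation g q)
    (hη : IsPrincipalBundle K η) (T : CharacteristicMap K q η) {f f' : gaugeGroup K P}
    (h : ∀ w, f.1 (T.lift w) = f'.1 (T.lift w)) : f = f' := by
  refine Subtype.ext (ContinuousMap.ext fun p => ?_)
  obtain ⟨k, w, rfl⟩ := exists_smul_lift hq hη T p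
  rw [f.2, f'.2, h]

theorem gauge_skeletonSection [IsTopologicalGroup K] (T : CharacteristicMap K q η)
    (f : gaugeGroup K P) (t : I) : f.1 (T.skeletonSection t) =
      (T.loop fun _ => t)⁻¹ * f.1 (T.lift (squareBoundary t)) * T.loop fun _ => t :=
  f.2 _ _

end CharacteristicMap

end GaugeExtension

/-! ### Loops on the sides of the polygon and their extension over the square -/

section Word

theorem coe_arcParam {g k : ℕ} (hk : k + 1 ≤ 4 * g) (s : I) :
    (arcParam g k s : ℝ) = (k + s) / (4 * g) := by
  have hk' : (k : ℝ) + 1 ≤ 4 * g := by exact_mod_cast hk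
  have hs0 := s.2.1
  have hs1 := s.2.2
  have hpos : (0 : ℝ) < 4 * g := by
    have : (0 : ℝ) ≤ k := Nat.cast_nonneg k
    linarith
  have hmem : ((k : ℝ) + s) / (4 * g) ∈ Set.Icc (0 : ℝ) 1 :=
    ⟨by positivity, (div_le_one hpos).2 (by linarith)⟩
  rw [arcParam, Set.projIcc_of_mem zero_le_one hmem]

theorem arcParam_one (g k : ℕ) : arcParam g k 1 = arcParam g (k + 1) 0 := by
  simp [arcParam]

theorem arcParam_zero_zero (g : ℕ) : arcParam g 0 0 = 0 := by
  simp [arcParam]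

@[fun_prop]
theorem continuous_arcParam (g k : ℕ) : Continuous (arcParam g k) :=
  (continuous_projIcc (h := zero_le_one)).comp (f := fun s : I => ((k : ℝ) + s) / (4 * g))
    (by fun_prop)

theorem exists_arcParam_eq {g : ℕ} (hg : g ≠ 0) (t : I) :
    ∃ k, k + 1 ≤ 4 * g ∧ ∃ s, arcParam g k s = t := by
  have hpos : (0 : ℝ) < 4 * g := by positivity
  rcases eq_or_lt_of_le t.2.2 with h | h
  · refine ⟨4 * g - 1, by omega, 1, Subtype.ext ?_⟩
    rw [coe_arcParam (by omega), h, Nat.cast_sub (by omega)]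
    push_cast
    rw [sub_add_cancel]
    exact div_self hpos.ne'
  · have h0 : 0 ≤ 4 * g * (t : ℝ) := mul_nonneg hpos.le t.2.1
    have hk : ⌊4 * g * (t : ℝ)⌋₊ < 4 * g := by
      rw [Nat.floor_lt h0]
      push_cast
      nlinarith
    refine ⟨⌊4 * g * (t : ℝ)⌋₊, hk, ⟨4 * g * (t : ℝ) - ⌊4 * g * (t : ℝ)⌋₊,
      sub_nonneg.2 (Nat.floor_le h0), ?_⟩, Subtype.ext ?_⟩
    · linarith [(Nat.lt_floor_add_one (4 * g * (t : ℝ))).le]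
    · rw [coe_arcParam hk]
      simp only
      field_simp
      ring

/-- The function of the boundary parameter which increases from `0` to `1` on the arc number `m`,
is `1` on the next arc, decreases to `0` on the arc after that, and vanishes elsewhere. -/
noncomputable def tent (g m : ℕ) (u : I) : I :=
  Set.projIcc 0 1 zero_le_one (min (4 * g * (u : ℝ) - m) (m + 3 - 4 * g * u))

@[fun_prop]
theorem continuous_tent (g m : ℕ) : Continuous (tent g m) :=
  (continuous_projIcc (h := zero_le_one)).comp
    (f := fun u : I => min (4 * g * (u : ℝ) - m) (m + 3 - 4 * g * u)) (by fun_prop)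

theorem tent_arcParam {g k : ℕ} (m : ℕ) (hk : k + 1 ≤ 4 * g) (s : I) :
    tent g m (arcParam g k s) =
      Set.projIcc 0 1 zero_le_one (min (k + (s : ℝ) - m) (m + 3 - (k + s))) := by
  have hpos : (4 * g : ℝ) ≠ 0 := by
    have : 4 * g ≠ 0 := by omega
    exact_mod_cast this
  rw [tent, coe_arcParam hk, mul_div_cancel₀ _ hpos]

theorem tent_of_lt {g k m : ℕ} (hk : k + 1 ≤ 4 * g) (h : k + 1 ≤ m) (s : I) :
    tent g m (arcParam g k s) = 0 := by
  have h' : (k : ℝ) + 1 ≤ m := by exact_mod_cast h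
  rw [tent_arcParam m hk]
  exact Set.projIcc_of_le_left _ (min_le_iff.2 (Or.inl (by linarith [s.2.2])))

theorem tent_of_gt {g k m : ℕ} (hk : k + 1 ≤ 4 * g) (h : m + 3 ≤ k) (s : I) :
    tent g m (arcParam g k s) = 0 := by
  have h' : (m : ℝ) + 3 ≤ k := by exact_mod_cast h
  rw [tent_arcParam m hk]
  exact Set.projIcc_of_le_left _ (min_le_iff.2 (Or.inr (by linarith [s.2.1])))

theorem tent_self {g m : ℕ} (hk : m + 1 ≤ 4 * g) (s : I) : tent g m (arcParam g m s) = s := by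
  rw [tent_arcParam m hk, min_eq_left (by linarith [s.2.2]), add_sub_cancel_left,
    Set.projIcc_val]

theorem tent_add_one {g m : ℕ} (hk : m + 1 + 1 ≤ 4 * g) (s : I) :
    tent g m (arcParam g (m + 1) s) = 1 := by
  rw [tent_arcParam m hk]
  push_cast
  exact Set.projIcc_of_right_le _ (le_min (by linarith [s.2.1]) (by linarith [s.2.2]))

theorem tent_add_two {g m : ℕ} (hk : m + 2 + 1 ≤ 4 * g) (s : I) :
    tent g m (arcParam g (m + 2) s) = unitInterval.symm s := by
  rw [tent_arcParam m hk]
  push_cast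
  rw [min_eq_right (by linarith [s.2.1]), ← Set.projIcc_val zero_le_one (unitInterval.symm s),
    unitInterval.coe_symm_eq]
  congr 1
  ring

theorem tent_zero (g m : ℕ) : tent g m 0 = 0 :=
  Set.projIcc_of_le_left _ (min_le_iff.2 (Or.inl (by simp)))

theorem tent_one {g m : ℕ} (h : m + 3 ≤ 4 * g) : tent g m 1 = 0 := by
  have h' : (m : ℝ) + 3 ≤ 4 * g := by exact_mod_cast h
  exact Set.projIcc_of_le_left _ (min_le_iff.2 (Or.inr (by simp only [Set.Icc.coe_one]; linarith)))

variable {K : Type*} [Group K] {g : ℕ}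

/-- For loops `x` in a group, indexed by the `2g` generators, the product
`∏ᵢ x_{aᵢ}(v · tent) x_{bᵢ}(v · tent)`. For `v = 1` it is the loop which runs through
`a₁ b₁ a₁⁻¹ b₁⁻¹ ⋯` on the sides of the polygon; for `v = 0` it is constant. -/
noncomputable def wordHomotopy (x : Fin g × Fin 2 → I → K) (u v : I) : K :=
  ((List.finRange g).map fun i =>
    x (i, 0) (v * tent g (4 * i) u) * x (i, 1) (v * tent g (4 * i + 1) u)).prod

theorem list_prod_map_eq_single {M : Type*} [Monoid M] (i : Fin g) {f : Fin g → M}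
    (hf : ∀ j, j ≠ i → f j = 1) : ((List.finRange g).map f).prod = f i := by
  rw [List.prod_map_eq_pow_single i f fun j hj _ => hf j hj,
    List.count_eq_one_of_mem (List.nodup_finRange g) (List.mem_finRange i), pow_one]

theorem wordHomotopy_eq_one {x : Fin g × Fin 2 → I → K} {u v : I}
    (h : ∀ i : Fin g, x (i, 0) (v * tent g (4 * i) u) * x (i, 1) (v * tent g (4 * i + 1) u) = 1) :
    wordHomotopy x u v = 1 := by
  refine List.prod_eq_one fun k hk => ?_
  obtain ⟨i, -, rfl⟩ := List.mem_map.1 hk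
  exact h i

theorem wordHomotopy_one_left (u v : I) :
    wordHomotopy (fun (_ : Fin g × Fin 2) (_ : I) => (1 : K)) u v = 1 :=
  wordHomotopy_eq_one fun _ => mul_one 1

variable {x : Fin g × Fin 2 → I → K}

theorem wordHomotopy_radius_zero (hx0 : ∀ j, x j 0 = 1) (u : I) : wordHomotopy x u 0 = 1 :=
  wordHomotopy_eq_one fun i => by simp [hx0]

theorem wordHomotopy_zero (hx0 : ∀ j, x j 0 = 1) (v : I) : wordHomotopy x 0 v = 1 :=
  wordHomotopy_eq_one fun i => by simp [tent_zero, hx0]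

theorem wordHomotopy_one (hx0 : ∀ j, x j 0 = 1) (v : I) : wordHomotopy x 1 v = 1 :=
  wordHomotopy_eq_one fun i => by
    rw [tent_one (by omega), tent_one (by omega), mul_zero, hx0, hx0, mul_one]

/-- On the four arcs belonging to the index `i`, only the `i`-th factor is nontrivial. -/
theorem wordHomotopy_arcParam (hx0 : ∀ j, x j 0 = 1) (i : Fin g) {r : ℕ} (hr : r < 4) (s : I) :
    wordHomotopy x (arcParam g (4 * i + r) s) 1 =
      x (i, 0) (tent g (4 * i) (arcParam g (4 * i + r) s)) *
        x (i, 1) (tent g (4 * i + 1) (arcParam g (4 * i + r) s)) := by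
  refine (list_prod_map_eq_single i fun j hj => ?_).trans (by simp)
  have hi := i.2
  rcases lt_or_gt_of_ne (Fin.val_ne_of_ne hj) with h | h
  · rw [tent_of_gt (by omega) (by omega), tent_of_gt (by omega) (by omega), mul_zero, hx0, hx0,
      mul_one]
  · rw [tent_of_lt (by omega) (by omega), tent_of_lt (by omega) (by omega), mul_zero, hx0, hx0,
      mul_one]

theorem wordHomotopy_arc_zero (hx0 : ∀ j, x j 0 = 1) (i : Fin g) (s : I) :
    wordHomotopy x (arcParam g (4 * i) s) 1 = x (i, 0) s := by
  have hi := i.2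
  have h := wordHomotopy_arcParam hx0 i (r := 0) (by omega) s
  rw [add_zero] at h
  rw [h, tent_self (by omega), tent_of_lt (by omega) (by omega), hx0, mul_one]

theorem wordHomotopy_arc_one (hx0 : ∀ j, x j 0 = 1) (hx1 : ∀ j, x j 1 = 1) (i : Fin g) (s : I) :
    wordHomotopy x (arcParam g (4 * i + 1) s) 1 = x (i, 1) s := by
  have hi := i.2
  rw [wordHomotopy_arcParam hx0 i (by omega), tent_self (by omega), tent_add_one (by omega), hx1,
    one_mul]

theorem wordHomotopy_arc_two (hx0 : ∀ j, x j 0 = 1) (hx1 : ∀ j, x j 1 = 1) (i : Fin g) (s : I) :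
    wordHomotopy x (arcParam g (4 * i + 2) s) 1 = x (i, 0) (unitInterval.symm s) := by
  have hi := i.2
  rw [wordHomotopy_arcParam hx0 i (by omega), tent_add_two (by omega),
    tent_add_one (m := 4 * i + 1) (by omega), hx1, mul_one]

theorem wordHomotopy_arc_three (hx0 : ∀ j, x j 0 = 1) (i : Fin g) (s : I) :
    wordHomotopy x (arcParam g (4 * i + 3) s) 1 = x (i, 1) (unitInterval.symm s) := by
  have hi := i.2
  rw [wordHomotopy_arcParam hx0 i (by omega), tent_of_gt (by omega) (by omega),
    tent_add_two (m := 4 * i + 1) (by omega), hx0, one_mul]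

/-- On the sides labelled by the generators, the word restricts to the given loops. -/
theorem wordHomotopy_side (hx0 : ∀ j, x j 0 = 1) (hx1 : ∀ j, x j 1 = 1) (i : Fin g) (ε : Fin 2)
    (s : I) : wordHomotopy x (arcParam g (4 * i + ε) s) 1 = x (i, ε) s := by
  fin_cases ε
  · exact wordHomotopy_arc_zero hx0 i s
  · exact wordHomotopy_arc_one hx0 hx1 i s

theorem continuous_wordHomotopy [TopologicalSpace K] [IsTopologicalGroup K] {Z : Type*}
    [TopologicalSpace Z] {x : Z → Fin g × Fin 2 → I → K}
    (hx : ∀ j, Continuous fun y : Z × I => x y.1 j y.2) :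
    Continuous fun y : Z × (I × I) => wordHomotopy (x y.1) y.2.1 y.2.2 := by
  refine continuous_list_prod _ fun i _ => ?_
  have h : ∀ (j : Fin g × Fin 2) (m : ℕ), Continuous fun y : Z × (I × I) =>
      x y.1 j (y.2.2 * tent g m y.2.1) := fun j m =>
    (hx j).comp (f := fun y : Z × (I × I) => (y.1, y.2.2 * tent g m y.2.1)) (by fun_prop)
  exact (h _ _).mul (h _ _)

variable {X : Type*} [TopologicalSpace X] {q : C(I^ Fin 2, X)}

theorem IsSurfacePresentation.wordHomotopy_eq (hq : IsSurfacePresentation g q)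
    (hx0 : ∀ j, x j 0 = 1) (hx1 : ∀ j, x j 1 = 1) {t u : I}
    (h : q (squareBoundary t) = q (squareBoundary u)) :
    wordHomotopy x t 1 = wordHomotopy x u 1 := by
  refine hq.eq_of_sides (f := fun t => wordHomotopy x t 1) ?_ (fun i s => ?_) (fun i s => ?_)
    (fun hg t u => ?_) h
  · simp only [wordHomotopy_zero hx0, wordHomotopy_one hx0]
  · simp only [wordHomotopy_arc_zero hx0, wordHomotopy_arc_two hx0 hx1, unitInterval.symm_symm]
  · simp only [wordHomotopy_arc_one hx0 hx1, wordHomotopy_arc_three hx0, unitInterval.symm_symm]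
  · subst hg
    simp [wordHomotopy]

/-- All vertices of the polygon are identified. -/
theorem IsSurfacePresentation.vertex_eq (hq : IsSurfacePresentation g q) (i : Fin g) {r : ℕ}
    (hr : r < 4) : q (squareBoundary (arcParam g (4 * i + r) 0)) = q (squareBoundary 0) := by
  have side : ∀ {w w'}, SideRel g w w' → q w = q w' := fun h => (hq.eq_iff _ _).2 (.rel _ _ h)
  have key : ∀ i : Fin g,
      q (squareBoundary (arcParam g (4 * i) 0)) =
        q (squareBoundary (arcParam g (4 * i + 3) 0)) ∧
      q (squareBoundary (arcParam g (4 * i + 1) 0)) =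
        q (squareBoundary (arcParam g (4 * i + 2) 0)) ∧
      q (squareBoundary (arcParam g (4 * i + 1) 0)) =
        q (squareBoundary (arcParam g (4 * (i + 1 : ℕ)) 0)) ∧
      q (squareBoundary (arcParam g (4 * i + 2) 0)) =
        q (squareBoundary (arcParam g (4 * i + 3) 0)) := by
    intro i
    have a0 := side (SideRel.a i 0)
    have a1 := side (SideRel.a i 1)
    have b0 := side (SideRel.b i 0)
    have b1 := side (SideRel.b i 1)
    simp only [unitInterval.symm_zero, unitInterval.symm_one, arcParam_one] at a0 a1 b0 b1
    exact ⟨a0, a1, b0, b1⟩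
  have h4 : ∀ k : ℕ, k < g → q (squareBoundary (arcParam g (4 * k) 0)) =
      q (squareBoundary 0) := by
    intro k
    induction k with
    | zero =>
      intro _
      rw [mul_zero, arcParam_zero_zero]
    | succ k ih =>
      intro hk
      obtain ⟨h1, h2, h3, h4⟩ := key ⟨k, by omega⟩
      rw [← ih (by omega), h1, ← h4, ← h2, h3]
  obtain ⟨h1, h2, h3, h5⟩ := key i
  have h := h4 i i.2
  interval_cases r
  · exact h
  · rw [h2, h5, ← h1, h]
  · rw [h5, ← h1, h]
  · rw [← h1, h]

end Word

section CellDecomposition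

variable {K P X : Type*} [Group K] [TopologicalSpace K] [TopologicalSpace P]
  [TopologicalSpace X] [MulAction Kᵐᵒᵖ P] {q : C(I^ Fin 2, X)} {η : P → X}
  {g : ℕ}

namespace CharacteristicMap

variable (T : CharacteristicMap K q η)

theorem loop_zero : (T.loop fun _ => 0) = 1 := T.loop.2 _ ⟨0, Or.inl rfl⟩

@[fun_prop]
theorem continuous_loop : Continuous fun t : I => T.loop fun _ => t :=
  T.loop.1.continuous.comp (by fun_prop)

/-- The extension over the square of the boundary function which is given by the word in the loops
`x` on the sides of the polygon, conjugated by the characteristic loop. -/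
noncomputable def fill (x : Fin g × Fin 2 → I → K) : (I^ Fin 2) → K :=
  ofPolar fun u v => (T.loop fun _ => u) * wordHomotopy x u v * (T.loop fun _ => u)⁻¹

variable {T}

theorem fill_squareBoundary {x : Fin g × Fin 2 → I → K} (hx0 : ∀ j, x j 0 = 1) (t : I) :
    T.fill x (squareBoundary t) =
      (T.loop fun _ => t) * wordHomotopy x t 1 * (T.loop fun _ => t)⁻¹ := by
  rw [← squarePolar_one]
  refine ofPolar_squarePolar (Φ := fun u v =>
    (T.loop fun _ => u) * wordHomotopy x u v * (T.loop fun _ => u)⁻¹) (fun u u' => ?_)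
    (fun v => ?_) t 1
  · simp [wordHomotopy_radius_zero hx0]
  · simp [wordHomotopy_zero hx0, wordHomotopy_one hx0]

theorem continuous_fill [IsTopologicalGroup K] {Z : Type*} [TopologicalSpace Z]
    [LocallyCompactSpace Z]
    {x : Z → Fin g × Fin 2 → I → K} (hx : ∀ j, Continuous fun y : Z × I => x y.1 j y.2)
    (hx0 : ∀ z j, x z j 0 = 1) : Continuous fun y : Z × (I^ Fin 2) => T.fill (x y.1) y.2 := by
  refine continuous_ofPolar (Φ := fun z u v =>
    (T.loop fun _ => u) * wordHomotopy (x z) u v * (T.loop fun _ => u)⁻¹) ?_ (fun z u u' => ?_)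
    (fun z v => ?_)
  · have h : Continuous fun y : Z × (I × I) => T.loop fun _ => y.2.1 :=
      T.continuous_loop.comp (by fun_prop)
    exact (h.mul (continuous_wordHomotopy hx)).mul h.inv
  · simp [wordHomotopy_radius_zero (hx0 z)]
  · simp [wordHomotopy_zero (hx0 z), wordHomotopy_one (hx0 z)]

theorem fill_one (w : I^ Fin 2) : T.fill (fun (_ : Fin g × Fin 2) (_ : I) => (1 : K)) w = 1 := by
  simp [fill, ofPolar, wordHomotopy_one_left]

theorem compatible_fill (hq : IsSurfacePresentation g q) {x : Fin g × Fin 2 → I → K}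
    (hx0 : ∀ j, x j 0 = 1) (hx1 : ∀ j, x j 1 = 1) : T.Compatible (T.fill x) := by
  intro t u h
  have := hq.wordHomotopy_eq hx0 hx1 h
  simp only [fill_squareBoundary hx0, this]
  group

theorem Compatible.mul {F F' : (I^ Fin 2) → K} (hF : T.Compatible F) (hF' : T.Compatible F') :
    T.Compatible (F * F') := by
  intro t u h
  have key : ∀ k a b : K, k⁻¹ * (a * b) * k = (k⁻¹ * a * k) * (k⁻¹ * b * k) := fun k a b => by
    group
  simp only [Pi.mul_apply, key, hF t u h, hF' t u h]

theorem compatible_of_boundary {F : (I^ Fin 2) → K} (hF : ∀ t, F (squareBoundary t) = 1) :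
    T.Compatible F := fun t u _ => by simp [hF]

theorem skeletonSection_zero : T.skeletonSection 0 = T.basePoint := by
  rw [skeletonSection, loop_zero, MulOpposite.op_one, one_smul, basePoint]

theorem continuous_skeletonSection (hη : IsPrincipalBundle K η) (T : CharacteristicMap K q η) :
    Continuous T.skeletonSection :=
  hη.continuous_action.comp ((T.lift.continuous.comp continuous_squareBoundary).prodMk
    T.continuous_loop)

variable [IsTopologicalGroup K]

variable (T) in
/-- The values of a gauge transformation on the section over the circles of the `1`-skeleton. -/
noncomputable def restrictSides (g : ℕ) (f : gaugeGroup K P) (j : Fin g × Fin 2) (s : I) : K :=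
  f.1 (T.skeletonSection (arcParam g (4 * j.1 + j.2) s))

theorem restrictSides_zero (hq : IsSurfacePresentation g q) (f : gaugeGroup K P)
    (j : Fin g × Fin 2) : T.restrictSides g f j 0 = f.1 T.basePoint := by
  rw [restrictSides, ← skeletonSection_zero]
  exact congrArg f.1 (T.compat _ _ (hq.vertex_eq j.1 (by omega)))

theorem restrictSides_one (hq : IsSurfacePresentation g q) (f : gaugeGroup K P)
    (j : Fin g × Fin 2) : T.restrictSides g f j 1 = f.1 T.basePoint := by
  rw [restrictSides, ← skeletonSection_zero, arcParam_one, add_assoc]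
  exact congrArg f.1 (T.compat _ _ (hq.vertex_eq j.1 (by omega)))

/-- A pointed gauge transformation is determined on the `1`-skeleton by its restrictions to the
circles `a₁, b₁, …`. -/
theorem gauge_skeletonSection_eq_word (hq : IsSurfacePresentation g q)
    {f : gaugeGroup K P} (hf : f.1 T.basePoint = 1) (t : I) :
    f.1 (T.skeletonSection t) = wordHomotopy (T.restrictSides g f) t 1 := by
  have hx0 : ∀ j, T.restrictSides g f j 0 = 1 := fun j => (restrictSides_zero hq f j).trans hf
  have hx1 : ∀ j, T.restrictSides g f j 1 = 1 := fun j => (restrictSides_one hq f j).trans hf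
  have side : ∀ {t u}, SideRel g (squareBoundary t) (squareBoundary u) →
      f.1 (T.skeletonSection t) = f.1 (T.skeletonSection u) := fun {t u} h =>
    congrArg f.1 (T.compat t u ((hq.eq_iff _ _).2 (.rel _ _ h)))
  rcases eq_or_ne g 0 with rfl | hg
  · rw [side (SideRel.collapse rfl t 0), skeletonSection_zero, hf]
    simp [wordHomotopy]
  · obtain ⟨k, hk, s, rfl⟩ := exists_arcParam_eq hg t
    obtain ⟨i, r, hr, rfl⟩ : ∃ (i : Fin g) (r : ℕ), r < 4 ∧ k = 4 * i + r :=
      ⟨⟨k / 4, by omega⟩, k % 4, by omega, by simp only; omega⟩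
    interval_cases r
    · exact (wordHomotopy_arc_zero hx0 i s).symm
    · exact (wordHomotopy_arc_one hx0 hx1 i s).symm
    · rw [wordHomotopy_arc_two hx0 hx1]
      have h := side (SideRel.a i (unitInterval.symm s))
      rw [unitInterval.symm_symm] at h
      exact h.symm
    · rw [wordHomotopy_arc_three hx0]
      have h := side (SideRel.b i (unitInterval.symm s))
      rw [unitInterval.symm_symm] at h
      exact h.symm

variable (T) in
/-- The quotient of a gauge transformation, as a function on the square, by the standard extension
of its restriction to the `1`-skeleton. -/
noncomputable def cellPart (g : ℕ) (f : gaugeGroup K P) (w : I^ Fin 2) : K :=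
  f.1 (T.lift w) * (T.fill (T.restrictSides g f) w)⁻¹

theorem cellPart_mul_fill (f : gaugeGroup K P) (w : I^ Fin 2) :
    T.cellPart g f w * T.fill (T.restrictSides g f) w = f.1 (T.lift w) :=
  inv_mul_cancel_right _ _

theorem cellPart_eq_one (hq : IsSurfacePresentation g q) {f : gaugeGroup K P}
    (hf : f.1 T.basePoint = 1) {w : I^ Fin 2} (hw : w ∈ Cube.boundary (Fin 2)) :
    T.cellPart g f w = 1 := by
  obtain ⟨t, rfl⟩ := exists_squareBoundary_eq hw
  rw [cellPart, fill_squareBoundary (fun j => (restrictSides_zero hq f j).trans hf),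
    ← gauge_skeletonSection_eq_word hq hf, gauge_skeletonSection]
  group

/-- A gauge transformation is determined by its two parts. -/
theorem gauge_eq (hq : IsSurfacePresentation g q) (hη : IsPrincipalBundle K η)
    (T : CharacteristicMap K q η) {f f' : gaugeGroup K P}
    (h : T.restrictSides g f = T.restrictSides g f') (h' : T.cellPart g f = T.cellPart g f') :
    f = f' :=
  gauge_ext hq hη T fun w => by
    rw [← cellPart_mul_fill (g := g) f, ← cellPart_mul_fill (g := g) f', h, h']

theorem restrictSides_one_gauge :
    T.restrictSides g (1 : gaugeGroup K P) = fun _ _ => 1 := rfl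

theorem cellPart_one_gauge : T.cellPart g (1 : gaugeGroup K P) = fun _ => 1 := by
  funext w
  rw [cellPart, restrictSides_one_gauge, fill_one, inv_one, mul_one]
  rfl

/-- Families of loops on the sides and of functions on the square vanishing on the boundary are
the two parts of a family of pointed gauge transformations. -/
theorem exists_gauge_of_parts (hq : IsSurfacePresentation g q) (hη : IsPrincipalBundle K η)
    (T : CharacteristicMap K q η) {Z : Type*} [TopologicalSpace Z] [LocallyCompactSpace Z]
    {x : Z → Fin g × Fin 2 → I → K} (hx : ∀ j, Continuous fun y : Z × I => x y.1 j y.2)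
    (hx0 : ∀ z j, x z j 0 = 1) (hx1 : ∀ z j, x z j 1 = 1) {h : Z → (I^ Fin 2) → K}
    (hh : Continuous fun y : Z × (I^ Fin 2) => h y.1 y.2)
    (hb : ∀ z, ∀ w ∈ Cube.boundary (Fin 2), h z w = 1) :
    ∃ f : C(Z, pointedGaugeGroup K T.basePoint),
      ∀ z, T.restrictSides g (f z).1 = x z ∧ T.cellPart g (f z).1 = h z := by
  have hb' : ∀ z t, h z (squareBoundary t) = 1 := fun z t => hb z _ (squareBoundary_mem_boundary t)
  let F : Z → (I^ Fin 2) → K := fun z => h z * T.fill (x z)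
  have hF : Continuous fun y : Z × (I^ Fin 2) => F y.1 y.2 := hh.mul (continuous_fill hx hx0)
  have hc : ∀ z, T.Compatible (F z) := fun z =>
    (compatible_of_boundary (hb' z)).mul (compatible_fill hq (hx0 z) (hx1 z))
  let f := gaugeFamily hq hη F hF hc
  have hf : ∀ z w, (f z).1 (T.lift w) = h z w * T.fill (x z) w := gaugeFamily_lift hq hη hF hc
  have hs : ∀ z t, (f z).1 (T.skeletonSection t) = wordHomotopy (x z) t 1 := by
    intro z t
    rw [gauge_skeletonSection, hf, hb', fill_squareBoundary (hx0 z)]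
    group
  have hp : ∀ z, f z ∈ pointedGaugeGroup K T.basePoint := by
    intro z
    change (f z).1 T.basePoint = 1
    rw [← skeletonSection_zero, hs, wordHomotopy_zero (hx0 z)]
  have hr : ∀ z, T.restrictSides g (f z) = x z := by
    intro z
    funext j s
    rw [restrictSides, hs]
    exact wordHomotopy_side (hx0 z) (hx1 z) j.1 j.2 s
  refine ⟨⟨fun z => ⟨f z, hp z⟩, by fun_prop⟩, fun z => ⟨hr z, funext fun w => ?_⟩⟩
  simp only [ContinuousMap.coe_mk, cellPart, hr, hf]
  exact mul_inv_cancel_right _ _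

/-- Evaluation of gauge transformations is jointly continuous along maps from locally compact
spaces. -/
theorem continuous_gauge_comp {Y Z : Type*} [TopologicalSpace Y] [LocallyCompactSpace Y]
    [TopologicalSpace Z] {f : Z → gaugeGroup K P} (hf : Continuous f) {r : Y → P}
    (hr : Continuous r) : Continuous fun y : Z × Y => (f y.1).1 (r y.2) := by
  have h : Continuous fun z => (f z).1.comp ⟨r, hr⟩ :=
    (ContinuousMap.continuous_precomp _).comp (continuous_subtype_val.comp hf)
  exact (h.comp continuous_fst).eval continuous_snd

theorem continuous_restrictSides (hη : IsPrincipalBundle K η) {Z : Type*} [TopologicalSpace Z]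
    {f : Z → gaugeGroup K P} (hf : Continuous f) (j : Fin g × Fin 2) :
    Continuous fun y : Z × I => T.restrictSides g (f y.1) j y.2 :=
  continuous_gauge_comp hf ((continuous_skeletonSection hη T).comp (continuous_arcParam _ _))

theorem continuous_cellPart (hq : IsSurfacePresentation g q) (hη : IsPrincipalBundle K η)
    {Z : Type*} [TopologicalSpace Z] [LocallyCompactSpace Z] {f : Z → gaugeGroup K P}
    (hf : Continuous f) (hp : ∀ z, (f z).1 T.basePoint = 1) :
    Continuous fun y : Z × (I^ Fin 2) => T.cellPart g (f y.1) y.2 :=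
  (continuous_gauge_comp hf T.lift.continuous).mul
    (continuous_fill (continuous_restrictSides hη hf)
      fun z j => (restrictSides_zero hq (f z) j).trans (hp z)).inv

end CharacteristicMap

end CellDecomposition

/-! ### Homotopy groups of the pointed gauge group -/

section PointedGaugeGroup

variable {K P X : Type*} [Group K] [TopologicalSpace K] [IsTopologicalGroup K]
  [TopologicalSpace P] [TopologicalSpace X] [MulAction Kᵐᵒᵖ P] {q : C(I^ Fin 2, X)} {η : P → X}
  {g : ℕ}

namespace CharacteristicMap

variable {T : CharacteristicMap K q η} {n : ℕ}

/-- The loops of cubes in `K` obtained from a cube of pointed gauge transformations by restriction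
to the circles of the `1`-skeleton. -/
noncomputable def sideLoop (hq : IsSurfacePresentation g q) (hη : IsPrincipalBundle K η)
    (G : Ω^ (Fin n) (pointedGaugeGroup K T.basePoint) 1) (j : Fin g × Fin 2) :
    Ω^ (Fin (n + 1)) K 1 :=
  ⟨⟨fun z => T.restrictSides g (G (Fin.init z)).1 j (z (Fin.last n)),
    (continuous_restrictSides hη (f := fun z => (G z).1) (by fun_prop) j).comp
      (f := fun z : I^ Fin (n + 1) => ((Fin.init z : I^ Fin n), z (Fin.last n))) (by fun_prop)⟩,
    fun z hz => by
      rw [Cube.mem_boundary_succ] at hz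
      rcases hz with hz | hz | hz
      · have : G (Fin.init z) = 1 := G.2 _ hz
        simp [this, restrictSides_one_gauge]
      · simp only [ContinuousMap.coe_mk, hz, restrictSides_zero hq]
        exact (G (Fin.init z)).2
      · simp only [ContinuousMap.coe_mk, hz, restrictSides_one hq]
        exact (G (Fin.init z)).2⟩

/-- The cube in `K` obtained from a cube of pointed gauge transformations by passing to the
parts on the `2`-cell. -/
noncomputable def cellLoop (hq : IsSurfacePresentation g q) (hη : IsPrincipalBundle K η)
    (G : Ω^ (Fin n) (pointedGaugeGroup K T.basePoint) 1) : Ω^ (Fin (n + 2)) K 1 :=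
  ⟨⟨fun y => T.cellPart g (G fun i => y (Fin.castAdd 2 i)).1 fun j => y (Fin.natAdd n j),
    (continuous_cellPart hq hη (f := fun z => (G z).1) (by fun_prop) fun z => (G z).2).comp
      (f := fun y : I^ Fin (n + 2) => ((fun i => y (Fin.castAdd 2 i) : I^ Fin n),
        (fun j => y (Fin.natAdd n j) : I^ Fin 2))) (by fun_prop)⟩,
    fun y hy => by
      rw [← Cube.append_castAdd_natAdd y, Cube.append_mem_boundary_iff] at hy
      rcases hy with hy | hy
      · have : G (fun i => y (Fin.castAdd 2 i)) = 1 := G.2 _ hy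
        simp [this, cellPart_one_gauge]
      · exact cellPart_eq_one hq (G _).2 hy⟩

theorem sideLoop_apply (hq : IsSurfacePresentation g q) (hη : IsPrincipalBundle K η)
    (G : Ω^ (Fin n) (pointedGaugeGroup K T.basePoint) 1) (j : Fin g × Fin 2)
    (z : I^ Fin (n + 1)) : sideLoop hq hη G j z =
      T.restrictSides g (G (Fin.init z)).1 j (z (Fin.last n)) := rfl

theorem cellLoop_apply (hq : IsSurfacePresentation g q) (hη : IsPrincipalBundle K η)
    (G : Ω^ (Fin n) (pointedGaugeGroup K T.basePoint) 1) (y : I^ Fin (n + 2)) :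
    cellLoop hq hη G y =
      T.cellPart g (G fun i => y (Fin.castAdd 2 i)).1 fun j => y (Fin.natAdd n j) := rfl

theorem sideLoop_homotopic (hq : IsSurfacePresentation g q) (hη : IsPrincipalBundle K η)
    {G G' : Ω^ (Fin n) (pointedGaugeGroup K T.basePoint) 1} (h : GenLoop.Homotopic G G')
    (j : Fin g × Fin 2) :
    GenLoop.Homotopic (sideLoop hq hη G j) (sideLoop hq hη G' j) := by
  rw [GenLoop.homotopic_iff] at h ⊢
  obtain ⟨H, h0, h1, hb⟩ := h
  refine ⟨⟨fun y => T.restrictSides g (H (y.1, Fin.init y.2)).1 j (y.2 (Fin.last n)),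
    (continuous_restrictSides hη (f := fun z => (H z).1) (by fun_prop) j).comp
      (f := fun y : I × (I^ Fin (n + 1)) => ((y.1, (Fin.init y.2 : I^ Fin n)), y.2 (Fin.last n)))
      (by fun_prop)⟩, fun z => ?_, fun z => ?_, fun t z hz => ?_⟩
  · simp [h0, sideLoop_apply]
  · simp [h1, sideLoop_apply]
  · rw [Cube.mem_boundary_succ] at hz
    rcases hz with hz | hz | hz
    · simp [hb t _ hz, restrictSides_one_gauge]
    · simp only [ContinuousMap.coe_mk, hz, restrictSides_zero hq]
      exact (H _).2
    · simp only [ContinuousMap.coe_mk, hz, restrictSides_one hq]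
      exact (H _).2

theorem cellLoop_homotopic (hq : IsSurfacePresentation g q) (hη : IsPrincipalBundle K η)
    {G G' : Ω^ (Fin n) (pointedGaugeGroup K T.basePoint) 1} (h : GenLoop.Homotopic G G') :
    GenLoop.Homotopic (cellLoop hq hη G) (cellLoop hq hη G') := by
  rw [GenLoop.homotopic_iff] at h ⊢
  obtain ⟨H, h0, h1, hb⟩ := h
  refine ⟨⟨fun y => T.cellPart g (H (y.1, fun i => y.2 (Fin.castAdd 2 i))).1
    fun j => y.2 (Fin.natAdd n j),
    (continuous_cellPart hq hη (f := fun z => (H z).1) (by fun_prop) fun z => (H z).2).comp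
      (f := fun y : I × (I^ Fin (n + 2)) => ((y.1, (fun i => y.2 (Fin.castAdd 2 i) : I^ Fin n)),
        (fun j => y.2 (Fin.natAdd n j) : I^ Fin 2))) (by fun_prop)⟩,
    fun z => ?_, fun z => ?_, fun t y hy => ?_⟩
  · simp [h0, cellLoop_apply]
  · simp [h1, cellLoop_apply]
  · rw [← Cube.append_castAdd_natAdd y, Cube.append_mem_boundary_iff] at hy
    rcases hy with hy | hy
    · simp [hb t _ hy, cellPart_one_gauge]
    · exact cellPart_eq_one hq (H _).2 hy

/-- Cubes of loops and of spheres in `K`, with arbitrary parameters, come from families of pointed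
gauge transformations. -/
theorem exists_gauge_of_loops (hq : IsSurfacePresentation g q) (hη : IsPrincipalBundle K η)
    (T : CharacteristicMap K q η) {Z : Type*} [TopologicalSpace Z] [LocallyCompactSpace Z]
    (x : Fin g × Fin 2 → C(Z × (I^ Fin (n + 1)), K)) (h : C(Z × (I^ Fin (n + 2)), K))
    (hx : ∀ j s, ∀ z ∈ Cube.boundary (Fin (n + 1)), x j (s, z) = 1)
    (hh : ∀ s, ∀ y ∈ Cube.boundary (Fin (n + 2)), h (s, y) = 1) :
    ∃ f : C(Z × (I^ Fin n), pointedGaugeGroup K T.basePoint),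
      (∀ s z, T.restrictSides g (f (s, z)).1 = fun j u => x j (s, Fin.snoc z u)) ∧
      (∀ s z, T.cellPart g (f (s, z)).1 = fun w => h (s, (Fin.append z w : I^ Fin (n + 2)))) ∧
      ∀ s, ∀ z ∈ Cube.boundary (Fin n), f (s, z) = 1 := by
  obtain ⟨f, hf⟩ := exists_gauge_of_parts hq hη T (Z := Z × (I^ Fin n))
    (x := fun z j u => x j (z.1, Fin.snoc z.2 u))
    (h := fun z w => h (z.1, (Fin.append z.2 w : I^ Fin (n + 2))))
    (fun j => by fun_prop)
    (fun z j => hx j _ _ (Cube.snoc_mem_boundary_iff.2 (by simp)))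
    (fun z j => hx j _ _ (Cube.snoc_mem_boundary_iff.2 (by simp)))
    (by fun_prop)
    (fun z w hw => hh _ _ (Cube.append_mem_boundary_iff.2 (Or.inr hw)))
  refine ⟨f, fun s z => (hf (s, z)).1, fun s z => (hf (s, z)).2, fun s z hz => Subtype.ext ?_⟩
  refine gauge_eq (g := g) hq hη T ?_ ?_
  · rw [(hf (s, z)).1]
    funext j u
    exact hx j _ _ (Cube.snoc_mem_boundary_iff.2 (Or.inl hz))
  · rw [(hf (s, z)).2]
    refine (funext fun w => ?_).trans cellPart_one_gauge.symm
    exact hh _ _ (Cube.append_mem_boundary_iff.2 (Or.inl hz))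

theorem exists_genLoop_of_loops (hq : IsSurfacePresentation g q) (hη : IsPrincipalBundle K η)
    (T : CharacteristicMap K q η) (x : Fin g × Fin 2 → Ω^ (Fin (n + 1)) K 1)
    (h : Ω^ (Fin (n + 2)) K 1) :
    ∃ G : Ω^ (Fin n) (pointedGaugeGroup K T.basePoint) 1,
      (∀ j, sideLoop hq hη G j = x j) ∧ cellLoop hq hη G = h := by
  obtain ⟨f, fs, fc, fb⟩ := exists_gauge_of_loops hq hη T (Z := Unit)
    (fun j => (x j).1.comp ContinuousMap.snd) (h.1.comp ContinuousMap.snd)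
    (fun j _ z hz => (x j).2 z hz) (fun _ y hy => h.2 y hy)
  refine ⟨⟨⟨fun z => f ((), z), by fun_prop⟩, fb ()⟩, fun j => ?_, ?_⟩
  · ext z
    refine (congrFun (congrFun (fs () (Fin.init z)) j) _).trans ?_
    simp only [ContinuousMap.comp_apply, ContinuousMap.snd_apply, Fin.snoc_init_self]
    rfl
  · ext y
    refine (congrFun (fc () fun i => y (Fin.castAdd 2 i)) _).trans ?_
    simp only [ContinuousMap.comp_apply, ContinuousMap.snd_apply]
    exact congrArg h (Cube.append_castAdd_natAdd y)

/-- Homotopies of both parts of two cubes of pointed gauge transformations are the parts of a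
homotopy between the cubes. -/
theorem homotopic_of_loops (hq : IsSurfacePresentation g q) (hη : IsPrincipalBundle K η)
    {G G' : Ω^ (Fin n) (pointedGaugeGroup K T.basePoint) 1}
    (hs : ∀ j, GenLoop.Homotopic (sideLoop hq hη G j) (sideLoop hq hη G' j))
    (hc : GenLoop.Homotopic (cellLoop hq hη G) (cellLoop hq hη G')) : GenLoop.Homotopic G G' := by
  simp only [GenLoop.homotopic_iff] at hs hc ⊢
  choose x x0 x1 xb using hs
  obtain ⟨h, h0, h1, hb⟩ := hc
  obtain ⟨f, fs, fc, fb⟩ := exists_gauge_of_loops hq hη T x h xb hb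
  refine ⟨f, fun z => Subtype.ext (gauge_eq (g := g) hq hη T ?_ ?_),
    fun z => Subtype.ext (gauge_eq (g := g) hq hη T ?_ ?_), fb⟩
  · rw [fs]
    funext j u
    rw [x0, sideLoop_apply, Fin.init_snoc, Fin.snoc_last]
  · rw [fc]
    funext w
    rw [h0, cellLoop_apply]
    simp
  · rw [fs]
    funext j u
    rw [x1, sideLoop_apply, Fin.init_snoc, Fin.snoc_last]
  · rw [fc]
    funext w
    rw [h1, cellLoop_apply]
    simp

/-- The splitting `π_n(C_*(P, K)^K) → π_{n+1}(K)^{2g} × π_{n+2}(K)`, given by restriction to the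
sides and by the part on the `2`-cell. -/
noncomputable def splitting (hq : IsSurfacePresentation g q) (hη : IsPrincipalBundle K η)
    (T : CharacteristicMap K q η) (n : ℕ) (d : π_ n (pointedGaugeGroup K T.basePoint) 1) :
    ((Fin g × Fin 2) → π_ (n + 1) K 1) × π_ (n + 2) K 1 :=
  (fun j => Quotient.map (fun G => sideLoop hq hη G j)
    (fun _ _ h => sideLoop_homotopic hq hη h j) d,
    Quotient.map (cellLoop hq hη) (fun _ _ h => cellLoop_homotopic hq hη h) d)

theorem splitting_cls (hq : IsSurfacePresentation g q) (hη : IsPrincipalBundle K η)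
    (G : Ω^ (Fin n) (pointedGaugeGroup K T.basePoint) 1) :
    splitting hq hη T n (HomotopyGroup.cls G) =
      (fun j => HomotopyGroup.cls (sideLoop hq hη G j), HomotopyGroup.cls (cellLoop hq hη G)) :=
  rfl

theorem splitting_bijective (hq : IsSurfacePresentation g q) (hη : IsPrincipalBundle K η)
    (T : CharacteristicMap K q η) (n : ℕ) : Function.Bijective (splitting hq hη T n) := by
  constructor
  · intro d d' h
    obtain ⟨G, rfl⟩ := HomotopyGroup.exists_cls d
    obtain ⟨G', rfl⟩ := HomotopyGroup.exists_cls d'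
    rw [splitting_cls, splitting_cls, Prod.mk.injEq] at h
    exact HomotopyGroup.cls_eq_iff.2 (homotopic_of_loops hq hη
      (fun j => HomotopyGroup.cls_eq_iff.1 (congrFun h.1 j)) (HomotopyGroup.cls_eq_iff.1 h.2))
  · rintro ⟨x, h⟩
    choose x' hx' using fun j => HomotopyGroup.exists_cls (x j)
    obtain ⟨h', rfl⟩ := HomotopyGroup.exists_cls h
    obtain ⟨G, hs, hc⟩ := exists_genLoop_of_loops hq hη T x' h'
    refine ⟨HomotopyGroup.cls G, ?_⟩
    rw [splitting_cls, hc]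
    simp only [hs, hx']

/-- Restriction to the sides and passage to the part on the `2`-cell are defined pointwise, hence
compatible with concatenation. -/
theorem splitting_mul (hq : IsSurfacePresentation g q) (hη : IsPrincipalBundle K η)
    (d d' : π_ (n + 1) (pointedGaugeGroup K T.basePoint) 1) :
    splitting hq hη T (n + 1) (d * d') =
      splitting hq hη T (n + 1) d * splitting hq hη T (n + 1) d' := by
  obtain ⟨G, rfl⟩ := HomotopyGroup.exists_cls d
  obtain ⟨G', rfl⟩ := HomotopyGroup.exists_cls d'
  rw [HomotopyGroup.cls_mul 0]
  simp only [splitting_cls]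
  refine Prod.ext (funext fun j => ?_) ?_
  · simp only [Prod.fst_mul, Pi.mul_apply]
    rw [HomotopyGroup.cls_mul (Fin.castSucc 0)]
    refine congrArg HomotopyGroup.cls (GenLoop.ext _ _ fun z => ?_)
    have hi : ∀ a, (Fin.init (Function.update z (Fin.castSucc 0) a) : I^ Fin (n + 1)) =
        Function.update (Fin.init z) 0 a := fun a => Fin.init_update_castSucc _ _ _
    have hl : ∀ a, Function.update z (Fin.castSucc (0 : Fin (n + 1))) a (Fin.last (n + 1)) =
        z (Fin.last (n + 1)) := fun a =>
      Function.update_of_ne (Fin.castSucc_lt_last _).ne' _ _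
    have hz : (Fin.init z : I^ Fin (n + 1)) 0 = z (Fin.castSucc 0) := rfl
    simp only [sideLoop_apply, GenLoop.transAt_apply, hi, hl, hz]
    split_ifs <;> rfl
  · simp only [Prod.snd_mul]
    rw [HomotopyGroup.cls_mul (Fin.castAdd 2 0)]
    refine congrArg HomotopyGroup.cls (GenLoop.ext _ _ fun y => ?_)
    have hi : ∀ a, (fun i => Function.update y (Fin.castAdd 2 0) a (Fin.castAdd 2 i) :
        I^ Fin (n + 1)) = Function.update (fun i => y (Fin.castAdd 2 i)) 0 a := fun a => by
      funext i
      simp only [Function.update_apply, Fin.castAdd_inj]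
    have hl : ∀ a, (fun i => Function.update y (Fin.castAdd 2 (0 : Fin (n + 1))) a
        (Fin.natAdd (n + 1) i) : I^ Fin 2) = fun i => y (Fin.natAdd (n + 1) i) := fun a => by
      funext i
      refine Function.update_of_ne (fun h => ?_) _ _
      have := congrArg Fin.val h
      simp at this
    simp only [cellLoop_apply, GenLoop.transAt_apply, hi, hl]
    split_ifs <;> rfl

theorem splitting_one (hq : IsSurfacePresentation g q) (hη : IsPrincipalBundle K η) :
    splitting hq hη T n (HomotopyGroup.basePt 1) = 1 := by
  rw [← HomotopyGroup.cls_const, splitting_cls]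
  refine Prod.ext (funext fun j => ?_) ?_
  · exact congrArg HomotopyGroup.cls (GenLoop.ext _ GenLoop.const fun z => rfl)
  · exact congrArg HomotopyGroup.cls (GenLoop.ext _ GenLoop.const fun y =>
      congrFun cellPart_one_gauge _)

end CharacteristicMap

end PointedGaugeGroup

/-! ### Lifting of paths to the gauge group and the connecting map -/

section Connecting

variable {K P X : Type*} [Group K] [TopologicalSpace K] [IsTopologicalGroup K]
  [TopologicalSpace P] [TopologicalSpace X] [MulAction Kᵐᵒᵖ P] {q : C(I^ Fin 2, X)} {η : P → X}
  {g : ℕ}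

namespace CharacteristicMap

/-- Paths `κ` in `K` starting at `1` are lifted to paths of gauge transformations which take the
constant value `κ t` on the `1`-skeleton. In the square, they are given by the commutators of the
characteristic loop and `κ`. -/
theorem exists_path_lift (hq : IsSurfacePresentation g q) (hη : IsPrincipalBundle K η)
    (T : CharacteristicMap K q η) {Z : Type*} [TopologicalSpace Z] [LocallyCompactSpace Z]
    (κ : C(Z × I, K)) (h0 : ∀ z, κ (z, 0) = 1) :
    ∃ L : C(Z × I, gaugeGroup K P), (∀ z, L (z, 0) = 1) ∧
      (∀ z t u, (L (z, t)).1 (T.skeletonSection u) = κ (z, t)) ∧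
      (∀ z, (∀ t, κ (z, t) = 1) → ∀ t, L (z, t) = 1) ∧
      ∀ z t u v, (L (z, t)).1 (T.lift (squarePolar u v)) = (T.loop fun _ => u) * κ (z, t * v) *
        (T.loop fun _ => u)⁻¹ * (κ (z, t * v))⁻¹ * κ (z, t) := by
  let Φ : Z × I → I → I → K := fun y u v => (T.loop fun _ => u) * κ (y.1, y.2 * v) *
        (T.loop fun _ => u)⁻¹ * (κ (y.1, y.2 * v))⁻¹ * κ y
  have hΦ : Continuous fun y : (Z × I) × (I × I) => Φ y.1 y.2.1 y.2.2 := by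
    have h : Continuous fun y : (Z × I) × (I × I) => T.loop fun _ => y.2.1 :=
      T.continuous_loop.comp (by fun_prop)
    fun_prop
  have hΦ0 : ∀ y u u', Φ y u 0 = Φ y u' 0 := fun y u u' => by simp [Φ, h0]
  have hγ1 : (T.loop fun _ => 1) = 1 := T.loop.2 _ ⟨0, Or.inr rfl⟩
  have hΦ1 : ∀ y v, Φ y 0 v = Φ y 1 v := fun y v => by simp [Φ, hγ1, loop_zero]
  have hp : ∀ y u v, ofPolar (Φ y) (squarePolar u v) = Φ y u v := fun y =>
    ofPolar_squarePolar (hΦ0 y) (hΦ1 y)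
  have hbd : ∀ y u, ofPolar (Φ y) (squareBoundary u) =
      (T.loop fun _ => u) * κ y * (T.loop fun _ => u)⁻¹ := fun y u => by
    rw [← squarePolar_one, hp]
    simp [Φ]
  have hc : ∀ y, T.Compatible (ofPolar (Φ y)) := fun y t u _ => by
    rw [hbd, hbd]
    group
  have hF := continuous_ofPolar hΦ hΦ0 hΦ1
  let L := gaugeFamily hq hη (fun y => ofPolar (Φ y)) hF hc
  have hL : ∀ y w, (L y).1 (T.lift w) = ofPolar (Φ y) w := gaugeFamily_lift hq hη hF hc
  have hL' : ∀ y u v, (L y).1 (T.lift (squarePolar u v)) = Φ y u v := fun y u v =>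
    (hL y _).trans (hp y u v)
  have hone : ∀ y, (∀ u v, Φ y u v = 1) → L y = 1 := fun y hy => gauge_ext hq hη T fun w => by
    obtain ⟨⟨u, v⟩, rfl⟩ := squarePolar_surjective w
    exact (hL' y u v).trans (hy u v)
  refine ⟨L, fun z => hone _ fun u v => ?_, fun z t u => ?_, fun z hz t => hone _ fun u v => ?_,
    fun z t u v => hL' (z, t) u v⟩
  · simp [Φ, h0]
  · rw [gauge_skeletonSection, hL, hbd]
    group
  · simp [Φ, hz]

theorem hasRegularLifting_gaugeEval (hq : IsSurfacePresentation g q) (hη : IsPrincipalBundle K η)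
    (T : CharacteristicMap K q η) : HasRegularLifting (gaugeEval K T.basePoint) := by
  intro n κ h0
  obtain ⟨L, L0, Ls, Lc, -⟩ := exists_path_lift hq hη T κ h0
  refine ⟨L, L0, fun y => ?_, Lc⟩
  have := Ls y.1 y.2 0
  rwa [skeletonSection_zero] at this

theorem castAdd_append {n : ℕ} (z : I^ Fin n) (w : I^ Fin 2) :
    (fun i : Fin (n + 1) => (Fin.append z w : I^ Fin (n + 2)) (Fin.castAdd 1 i)) =
      Fin.snoc z (w 0) := by
  funext i
  induction i using Fin.lastCases with
  | last =>
    rw [Fin.snoc_last]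
    exact Fin.append_right z w 0
  | cast i =>
    rw [Fin.snoc_castSucc]
    exact Fin.append_left z w i

/-- The connecting map of the evaluation fibration: the values of the lift of `α` on the square
are, in polar coordinates, the inverses of the commutators of `α` and the characteristic loop. -/
theorem exists_isConnecting_splitting (hq : IsSurfacePresentation g q)
    (hη : IsPrincipalBundle K η) (T : CharacteristicMap K q η) {n : ℕ} (a : π_ (n + 1) K 1) :
    ∃ d, IsConnecting (e := (1 : gaugeGroup K P)) (gaugeIncl K T.basePoint)
      (gaugeEval K T.basePoint) a d ∧
      splitting hq hη T n d = (1, (samelson a T.charClass)⁻¹) := by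
  obtain ⟨α, rfl⟩ := HomotopyGroup.exists_cls a
  obtain ⟨L, L0, Ls, Lc, Lp⟩ := exists_path_lift hq hη T (Z := I^ Fin n)
    ⟨fun y => α (Fin.snoc y.1 y.2), by fun_prop⟩
    (fun z => α.2 _ (Cube.snoc_mem_boundary_iff.2 (by simp)))
  simp only [ContinuousMap.coe_mk] at Ls Lc Lp
  have hα1 : ∀ z : I^ Fin n, α (Fin.snoc z 1) = 1 := fun z =>
    α.2 _ (Cube.snoc_mem_boundary_iff.2 (by simp))
  have Lb : ∀ t, ∀ z ∈ Cube.boundary (Fin n), L (z, t) = 1 := fun t z hz =>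
    Lc z (fun t => α.2 _ (Cube.snoc_mem_boundary_iff.2 (Or.inl hz))) t
  have hbase : ∀ z t, (L (z, t)).1 T.basePoint = α (Fin.snoc z t) := fun z t => by
    rw [← skeletonSection_zero, Ls]
  let G : Ω^ (Fin n) (pointedGaugeGroup K T.basePoint) 1 :=
    ⟨⟨fun z => ⟨L (z, 1), (hbase z 1).trans (hα1 z)⟩, by fun_prop⟩,
      fun z hz => Subtype.ext (Lb 1 z hz)⟩
  have hside : ∀ z, T.restrictSides g (L (z, 1)) = fun _ _ => 1 := fun z => by
    funext j s
    rw [restrictSides, Ls, hα1]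
  have hcell : ∀ z w, T.cellPart g (L (z, 1)) w = (L (z, 1)).1 (T.lift w) := fun z w => by
    rw [cellPart, hside, fill_one, inv_one, mul_one]
  have hG : ∀ (z : I^ Fin n) w, cellLoop (g := g) hq hη G (Fin.append z w : I^ Fin (n + 2)) =
      (L (z, 1)).1 (T.lift w) := fun z w => by
    have h1 : (fun i => (Fin.append z w : I^ Fin (n + 2)) (Fin.castAdd 2 i)) = z :=
      funext fun i => Fin.append_left z w i
    have h2 : (fun j => (Fin.append z w : I^ Fin (n + 2)) (Fin.natAdd n j)) = w :=
      funext fun j => Fin.append_right z w j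
    rw [← hcell, cellLoop_apply, h1, h2]
    rfl
  refine ⟨HomotopyGroup.cls G, ?_, ?_⟩
  · exact IsConnecting.of_homotopy (F := pointedGaugeGroup K T.basePoint)
      ⟨fun y => L (y.2, y.1), by fun_prop⟩ α G (fun t z => hbase z t) L0 (fun z => rfl) Lb
  · rw [splitting_cls]
    refine Prod.ext (funext fun j => ?_) ?_
    · refine congrArg HomotopyGroup.cls (GenLoop.ext _ GenLoop.const fun z => ?_)
      exact congrFun (congrFun (hside _) j) _
    · refine Eq.trans ?_ (HomotopyGroup.cls_pointwiseInv (GenLoop.commutator α T.loop))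
      refine (HomotopyGroup.cls_eq_iff.2 (GenLoop.homotopic_comp_squarePolar _ _
        (fun z v => ?_) fun z w => ?_)).symm
      · rw [hG, Lp, loop_zero, hα1]
        group
      · rw [hG, Lp, hα1, one_mul]
        have h1 : (fun j : Fin 1 => (Fin.append z w : I^ Fin (n + 2)) (Fin.natAdd (n + 1) j)) =
            fun _ => w 1 := by
          funext j
          rw [Subsingleton.elim j 0]
          exact Fin.append_right z w 1
        change (α _ * T.loop _ * (α _)⁻¹ * (T.loop _)⁻¹)⁻¹ = _
        rw [castAdd_append, h1]
        group

end CharacteristicMap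

end Connecting

open CharacteristicMap in
theorem mainTheorem3 {K P X : Type*}
    [Group K] [TopologicalSpace K] [IsTopologicalGroup K] [ConnectedSpace K]
    (hK : LocallyContractibleSpace K)
    [TopologicalSpace P] [MulAction Kᵐᵒᵖ P] [TopologicalSpace X]
    (g : ℕ) (q : C(I^ Fin 2, X)) (hq : IsSurfacePresentation g q)
    (η : P → X) (hη : IsPrincipalBundle K η)
    (T : CharacteristicMap K q η) (b : π_ 1 K 1) (hb : T.charClass = b)
    (p₀ : P) (hp₀ : T.basePoint = p₀) :
    -- evaluation at the base point is a fibration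
    IsSerreFibration (gaugeEval K p₀) ∧
    ∃ (δ : ∀ n : ℕ, π_ (n + 1) K 1 → π_ n (pointedGaugeGroup K p₀) 1)
      (θ : ∀ n : ℕ, π_ n (pointedGaugeGroup K p₀) 1 ≃
        ((Fin g × Fin 2) → π_ (n + 1) K 1) × π_ (n + 2) K 1),
      -- `δ` is the connecting homomorphism of the evaluation fibration
      (∀ n a d, IsConnecting (e := (1 : gaugeGroup K P)) (gaugeIncl K p₀) (gaugeEval K p₀) a d ↔
        δ n a = d) ∧
      (∀ n a a', δ (n + 1) (a * a') = δ (n + 1) a * δ (n + 1) a') ∧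
      -- exactness of the long homotopy sequence
      (∀ n (a : π_ (n + 1) K 1), δ n a = HomotopyGroup.basePt 1 ↔
        a ∈ Set.range (HomotopyGroup.mapPt (N := Fin (n + 1)) (x := (1 : gaugeGroup K P))
          (gaugeEval K p₀) rfl)) ∧
      (∀ n (d : π_ n (pointedGaugeGroup K p₀) 1),
        HomotopyGroup.mapPt (y := (1 : gaugeGroup K P)) (gaugeIncl K p₀) rfl d =
          HomotopyGroup.basePt 1 ↔ d ∈ Set.range (δ n)) ∧
      (∀ n (u : π_ n (gaugeGroup K P) 1),
        HomotopyGroup.mapPt (y := (1 : K)) (gaugeEval K p₀) rfl u = HomotopyGroup.basePt 1 ↔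
          u ∈ Set.range (HomotopyGroup.mapPt (N := Fin n) (x := (1 : pointedGaugeGroup K p₀))
            (gaugeIncl K p₀) rfl)) ∧
      -- `θ n` is an isomorphism of groups for `n ≥ 1`, of pointed sets for `n = 0`
      (∀ n, θ n (HomotopyGroup.basePt 1) = 1) ∧
      (∀ n d d', θ (n + 1) (d * d') = θ (n + 1) d * θ (n + 1) d') ∧
      -- the component in `π_{n+1}(K)^{2g}` of `θ n` is restriction to the `2g` circles
      -- `a₁, b₁, …, a_g, b_g` of the `1`-skeleton
      (∀ n (G : Ω^ (Fin n) (pointedGaugeGroup K p₀) 1) (i : Fin g) (ε : Fin 2),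
        ∃ h : Ω^ (Fin (n + 1)) K 1,
          (∀ z, h z = (G fun j => z j.castSucc).1.1
            (T.skeletonSection (arcParam g (4 * i + ε) (z (Fin.last n))))) ∧
          (θ n (HomotopyGroup.cls G)).1 (i, ε) = HomotopyGroup.cls h) ∧
      -- the summand `π_{n+2}(K)` corresponds to the gauge transformations supported on the `2`-cell
      (∀ n (h : Ω^ (Fin (n + 2)) K 1), ∃ G : Ω^ (Fin n) (pointedGaugeGroup K p₀) 1,
          (∀ z, (G fun j => z (Fin.castAdd 2 j)).1.1 (T.lift fun j => z (Fin.natAdd n j)) = h z) ∧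
          θ n (HomotopyGroup.cls G) = (1, HomotopyGroup.cls h)) ∧
      -- the connecting homomorphism is `a ↦ (0, -⟨a, b⟩)`
      (∀ n (a : π_ (n + 1) K 1), θ n (δ n a) = (1, (samelson a b)⁻¹)) := by
  subst hb hp₀
  have hL := hasRegularLifting_gaugeEval hq hη T
  have hp : ∀ x y : gaugeGroup K P, gaugeEval K T.basePoint (x * y) =
    gaugeEval K T.basePoint x * gaugeEval K T.basePoint y := fun _ _ => rfl
  have hF : ∀ x : gaugeGroup K P, x ∈ pointedGaugeGroup K T.basePoint ↔
    gaugeEval K T.basePoint x = 1 := fun _ => Iff.rfl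
  choose δ hδ hδθ using fun (n : ℕ) (a : π_ (n + 1) K 1) =>
    exists_isConnecting_splitting hq hη T a
  have hiff : ∀ n a d, IsConnecting (e := (1 : gaugeGroup K P)) (gaugeIncl K T.basePoint)
      (gaugeEval K T.basePoint) a d ↔ δ n a = d := fun n a d =>
    ⟨fun h => hL.isConnecting_unique hp hF (hδ n a) h, fun h => h ▸ hδ n a⟩
  refine ⟨hL.isSerreFibration hp, δ, fun n => Equiv.ofBijective _ (splitting_bijective hq hη T n),
    hiff, fun n a a' => ?_, fun n a => ?_, fun n d => ?_, fun n u => ?_, fun n => ?_,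
    fun n d d' => ?_, fun n G i ε => ?_, fun n h => ?_, fun n a => ?_⟩
  · exact (hiff _ _ _).1 ((hδ _ a).mul hp (hδ _ a'))
  · rw [← hiff]
    exact isConnecting_basePt_iff hp hF rfl a
  · refine (exists_isConnecting_iff (p := gaugeEval K T.basePoint) rfl hF d).trans ?_
    exact exists_congr fun a => hiff n a d
  · exact hL.mapPt_eq_basePt_iff hp hF rfl u
  · exact splitting_one hq hη
  · exact splitting_mul hq hη d d'
  · exact ⟨sideLoop hq hη G (i, ε), fun z => rfl, rfl⟩
  · obtain ⟨G, hs, hc⟩ := exists_genLoop_of_loops hq hη T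
      (fun _ : Fin g × Fin 2 => GenLoop.const) h
    refine ⟨G, fun z => ?_, ?_⟩
    · rw [← cellPart_mul_fill (g := g)]
      have h1 : T.restrictSides g (G fun j => z (Fin.castAdd 2 j)).1 = fun _ _ => 1 := by
        funext j s
        have := congrArg (fun x => x (Fin.snoc (fun j => z (Fin.castAdd 2 j)) s)) (hs j)
        simpa [sideLoop_apply] using this
      rw [h1, fill_one, mul_one, ← hc, cellLoop_apply]
    · refine (splitting_cls hq hη G).trans ?_
      rw [hc]
      simp only [hs]
      rfl
  · exact hδθ n a
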